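/- Let $H_1$ be an infinite-dimensional separable real Hilbert space, $G_1$ a real Hilbert space, $S_1\colon H_1\to G_1$ a compact linear operator and $W_1=S_1^\dagger S_1$. Let $\{(e_m,\lambda_m) : m\in\mathbb N\}$ be the eigenpairs of $W_1$ in non-increasing order, i.e. $W_1e_m=\lambda_me_m$, $\langle e_i,e_j\rangle=\delta_{i,j}$, $\lambda_1\ge\lambda_2\ge\dots\ge0$, and $W_1$ vanishes on the orthogonal complement of $\{e_m\}$ (so every non-zero eigenvalue is listed with full multiplicity; this holds in particular if $\{e_m\}$ is an orthonormal basis of $H_1$). Let $d>1$. Let $H_d=H_1\otimes\dots\otimes H_1$ and $G_d=G_1\otimes\dots\otimes G_1$ be the $d$-fold Hilbert space tensor products, with $\langle\bigotimes f_l,\bigotimes g_l\rangle=\prod_l\langle f_l,g_l\rangle$, and let $S_d=S_1\otimes\dots\otimes S_1\colon H_d\to G_d$ and $W_d=S_d^\dagger S_d$. Let $\emptyset\ne I=\{i_1<\dots<i_{\#I}\}\subset\{1,\dots,d\}$, and let $\mathcal S_I$ be the set of permutations of $\{1,\dots,d\}$ that fix every element outside $I$. Let $P_I$ be either the symmetrizer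 or the antisymmetrizer with respect to $I$, that is, the continuous linear operator on $H_d$ (or on $G_d$) with $$P_I\Big(\bigotimes_{l=1}^d f_l\Big)=\frac1{\#\mathcal S_I}\sum_{\pi\in\mathcal S_I}\varepsilon(\pi)\bigotimes_{l=1}^d f_{\pi(l)},$$ where $\varepsilon(\pi)=1$ in the symmetric case and $\varepsilon(\pi)=\operatorname{sgn}\pi$ in the antisymmetric case. Its range $P_I(H_d)$ is a closed subspace. Let $$\nabla_d=\{k\in\mathbb N^d : k_{i_1}\le\dots\le k_{i_{\#I}}\}\ \text{(symmetric case)},\qquad \nabla_d=\{k\in\mathbb N^d : k_{i_1}<\dots<k_{i_{\#I}}\}\ \text{(antisymmetric case)}.$$ For $k\in\nabla_d$ put $$\xi_k=\sqrt{\#\mathcal S_I/M_I(k)!}\;P_I(e_{k_1}\otimes\dots\otimes e_{k_d}),\qquad \lambda_{d,k}=\prod_{l=1}^d\lambda_{k_l},$$ where $M_I(k)!$ is the product, over the distinct values $m$ among $(k_i)_{i\in I}$, of $(\#\{i\in I : k_i=m\})!$. Then there is a bijection $\psi\colon\mathbb N\to\nabla_d$ for which $(\lambda_{d,\psi(v)})_{v\in\mathbb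 N}$ is non-increasing, and for every such $\psi$ the following holds. 1. $W_d$ restricted to $P_I(H_d)$ equals $(S_d|_{P_I(H_d)})^\dagger S_d|_{P_I(H_d)}\colon P_I(H_d)\to P_I(H_d)$, and its eigenpairs in non-increasing order (in the sense above) are $\{(\xi_{\psi(v)},\lambda_{d,\psi(v)}) : v\in\mathbb N\}=\{(\xi_k,\lambda_{d,k}) : k\in\nabla_d\}$. If $\{e_m\}$ is an orthonormal basis of $H_1$, then $\{\xi_k : k\in\nabla_d\}$ is an orthonormal basis of $P_I(H_d)$. 2. For every $n\in\mathbb N_0$ the linear algorithm $$A^*_{n,d}f=\sum_{v=1}^n\langle f,\xi_{\psi(v)}\rangle_{H_d}\,S_d\xi_{\psi(v)},\qquad f\in P_I(H_d),$$ which uses $n$ continuous linear functionals, maps $P_I(H_d)$ into $P_I(G_d)$ and is $n$-th optimal for $S_d$ on $P_I(H_d)$ in the worst case setting: $$e(n,d;P_I(H_d))=e^{\rm wor}(A^*_{n,d};P_I(H_d))=\sqrt{\lambda_{d,\psi(n+1)}}.$$ Here $e^{\rm wor}(A;P_I(H_d))=\sup\{\|Af-S_df\|_{G_d} : f\in P_I(H_d),\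 \|f\|\le1\}$, and $e(n,d;P_I(H_d))=\inf_A e^{\rm wor}(A;P_I(H_d))$ is the infimum over the union of the following two classes of algorithms $A=\phi\circ N\colon P_I(H_d)\to G_d$ with arbitrary $\phi\colon\mathbb R^n\to G_d$: (a) $N(f)=(L_1(f),\dots,L_n(f))$ with continuous, not necessarily linear, functionals $L_v$; (b) adaptive linear information $N(f)=(y_1,\dots,y_n)$, $y_v=L_v(f;y_1,\dots,y_{v-1})$, where each $L_v(\cdot\,;y_1,\dots,y_{v-1})$ is a continuous linear functional. The infimum has the same value over every smaller class that contains all linear algorithms $f\mapsto\sum_{v=1}^nL_v(f)g_v$ with continuous linear functionals $L_v$ and $g_v\in G_d$. -/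

import Mathlib

open scoped TensorProduct Matrix

noncomputable section

/-! ### The `d`-fold Hilbert space tensor product -/

/-- The algebraic `d`-fold tensor product of `H` over the reals (finite linear combinations of
simple tensors), as a type of its own, so that it can carry the Hilbertian (cross) seminorm. -/
def AlgTensorPower (d : ℕ) (H : Type*) [AddCommGroup H] [Module ℝ H] : Type _ :=
  ⨂[ℝ] _ : Fin d, H

namespace AlgTensorPower

section Algebra

variable {d : ℕ} {H : Type*} [AddCommGroup H] [Module ℝ H]

instance : AddCommGroup (AlgTensorPower d H) :=
  inferInstanceAs (AddCommGroup (⨂[ℝ] _ : Fin d, H))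

instance : Module ℝ (AlgTensorPower d H) :=
  inferInstanceAs (Module ℝ (⨂[ℝ] _ : Fin d, H))

/-- The simple tensor `f 0 ⊗ ⋯ ⊗ f (d - 1)`. -/
def tprod (d : ℕ) (H : Type*) [AddCommGroup H] [Module ℝ H] :
    MultilinearMap ℝ (fun _ : Fin d => H) (AlgTensorPower d H) :=
  PiTensorProduct.tprod ℝ

theorem exists_sum (t : AlgTensorPower d H) :
    ∃ (n : ℕ) (c : Fin n → ℝ) (f : Fin n → Fin d → H), t = ∑ i, c i • tprod d H (f i) := by
  have ht : t ∈ Submodule.span ℝ (Set.range (tprod d H)) := by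
    have h : Submodule.span ℝ (Set.range (tprod d H)) = ⊤ :=
      PiTensorProduct.span_tprod_eq_top
    rw [h]
    trivial
  obtain ⟨n, c, g, hg⟩ := Submodule.mem_span_set'.1 ht
  choose f hf using fun i => (g i).2
  exact ⟨n, c, f, by rw [← hg]; simp [hf]⟩

theorem hom_ext {E : Type*} [AddCommGroup E] [Module ℝ E] {φ ψ : AlgTensorPower d H →ₗ[ℝ] E}
    (h : ∀ f, φ (tprod d H f) = ψ (tprod d H f)) : φ = ψ :=
  PiTensorProduct.ext (MultilinearMap.ext h)

end Algebra

variable {d : ℕ} {H G : Type*} [NormedAddCommGroup H] [InnerProductSpace ℝ H]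
  [NormedAddCommGroup G] [InnerProductSpace ℝ G]

/-- The bilinear form on the algebraic tensor product that is determined by
`⟨⊗ f_l, ⊗ g_l⟩ = ∏ ⟨f_l, g_l⟩`. -/
def form (d : ℕ) (H : Type*) [NormedAddCommGroup H] [InnerProductSpace ℝ H] :
    AlgTensorPower d H →ₗ[ℝ] AlgTensorPower d H →ₗ[ℝ] ℝ :=
  (PiTensorProduct.map₂ (R := ℝ) (fun _ : Fin d => innerₗ H)).compr₂
    (PiTensorProduct.lift (MultilinearMap.mkPiAlgebra ℝ (Fin d) ℝ))

theorem form_tprod (f g : Fin d → H) :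
    form d H (tprod d H f) (tprod d H g) = ∏ l, inner ℝ (f l) (g l) := by
  have h : form d H (tprod d H f) (tprod d H g) =
      PiTensorProduct.lift (MultilinearMap.mkPiAlgebra ℝ (Fin d) ℝ)
        (PiTensorProduct.map₂ (R := ℝ) (fun _ : Fin d => innerₗ H)
          (PiTensorProduct.tprod ℝ f) (PiTensorProduct.tprod ℝ g)) := rfl
  rw [h, PiTensorProduct.map₂_tprod_tprod]
  simp

theorem form_symm (s t : AlgTensorPower d H) : form d H s t = form d H t s := by
  have h : form d H = (form d H).flip :=
    hom_ext fun f => hom_ext fun g => by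
      simp only [LinearMap.flip_apply, form_tprod, real_inner_comm]
  exact congrArg (fun B => B s t) h

theorem form_sum {n : ℕ} (c : Fin n → ℝ) (f : Fin n → Fin d → H) :
    form d H (∑ i, c i • tprod d H (f i)) (∑ i, c i • tprod d H (f i)) =
      c ⬝ᵥ ((Matrix.of fun i j => ∏ l, inner ℝ (f i l) (f j l)) *ᵥ c) := by
  simp only [map_sum, map_smul, LinearMap.sum_apply, LinearMap.smul_apply, form_tprod,
    smul_eq_mul, dotProduct, Matrix.mulVec, Matrix.of_apply, Finset.mul_sum]
  rw [Finset.sum_comm]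
  refine Finset.sum_congr rfl fun i _ => Finset.sum_congr rfl fun j _ => ?_
  ring

theorem gram_bound {n : ℕ} (S : H →L[ℝ] G) (v : Fin n → H) :
    (Matrix.of fun i j =>
      ‖S‖ ^ 2 * inner ℝ (v i) (v j) - inner ℝ (S (v i)) (S (v j))).PosSemidef := by
  have h1 : (Matrix.of fun i j =>
      ‖S‖ ^ 2 * inner ℝ (v i) (v j) - inner ℝ (S (v i)) (S (v j))) =
      ‖S‖ ^ 2 • Matrix.gram ℝ v - Matrix.gram ℝ (fun i => S (v i)) := by
    ext i j
    simp [Matrix.gram_apply]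
  rw [h1]
  refine .of_dotProduct_mulVec_nonneg ?_ fun x => ?_
  · exact ((Matrix.isHermitian_gram ℝ v).smul (by simp [IsSelfAdjoint])).sub
      (Matrix.isHermitian_gram ℝ _)
  · rw [Matrix.sub_mulVec, dotProduct_sub, Matrix.smul_mulVec, dotProduct_smul,
      Matrix.star_dotProduct_gram_mulVec, Matrix.star_dotProduct_gram_mulVec]
    have h2 : ∑ i, x i • S (v i) = S (∑ i, x i • v i) := by simp
    rw [h2, real_inner_self_eq_norm_sq, real_inner_self_eq_norm_sq, smul_eq_mul, ← mul_pow,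
      sub_nonneg]
    exact pow_le_pow_left₀ (norm_nonneg _) (S.le_opNorm _) 2

theorem posSemidef_prod {n : ℕ} (f : Fin n → Fin d → H) (s : Finset (Fin d)) :
    (Matrix.of fun i j => ∏ l ∈ s, inner ℝ (f i l) (f j l)).PosSemidef := by
  induction s using Finset.induction_on with
  | empty =>
    have h : (Matrix.of fun i j => ∏ l ∈ (∅ : Finset (Fin d)), inner ℝ (f i l) (f j l)) =
        Matrix.gram ℝ (fun _ : Fin n => (1 : ℝ)) := by
      ext i j
      simp [Matrix.gram_apply]
    rw [h]
    exact Matrix.posSemidef_gram ℝ _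
  | insert a s ha ih =>
    have h : (Matrix.of fun i j => ∏ l ∈ insert a s, inner ℝ (f i l) (f j l)) =
        (Matrix.gram ℝ (fun i => f i a)).hadamard
          (Matrix.of fun i j => ∏ l ∈ s, inner ℝ (f i l) (f j l)) := by
      ext i j
      simp [Matrix.gram_apply, Finset.prod_insert ha]
    rw [h]
    exact (Matrix.posSemidef_gram ℝ _).hadamard ih

theorem posSemidef_bound {n : ℕ} (S : H →L[ℝ] G) (f : Fin n → Fin d → H) (s : Finset (Fin d)) :
    (Matrix.of fun i j => (∏ l ∈ s, ‖S‖ ^ 2 * inner ℝ (f i l) (f j l)) -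
      ∏ l ∈ s, inner ℝ (S (f i l)) (S (f j l))).PosSemidef := by
  induction s using Finset.induction_on with
  | empty =>
    simp only [Finset.prod_empty, sub_self]
    exact Matrix.PosSemidef.zero
  | insert a s ha ih =>
    have h : (Matrix.of fun i j => (∏ l ∈ insert a s, ‖S‖ ^ 2 * inner ℝ (f i l) (f j l)) -
        ∏ l ∈ insert a s, inner ℝ (S (f i l)) (S (f j l))) =
        (Matrix.of fun i j => ‖S‖ ^ 2 * inner ℝ (f i a) (f j a) -
          inner ℝ (S (f i a)) (S (f j a))).hadamard
          ((‖S‖ ^ 2) ^ s.card • Matrix.of fun i j => ∏ l ∈ s, inner ℝ (f i l) (f j l)) +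
        (Matrix.gram ℝ (fun i => S (f i a))).hadamard
          (Matrix.of fun i j => (∏ l ∈ s, ‖S‖ ^ 2 * inner ℝ (f i l) (f j l)) -
            ∏ l ∈ s, inner ℝ (S (f i l)) (S (f j l))) := by
      ext i j
      simp only [Matrix.of_apply, Matrix.add_apply, Matrix.hadamard_apply, Matrix.smul_apply,
        Matrix.gram_apply, Finset.prod_insert ha, Finset.prod_mul_distrib, Finset.prod_const,
        smul_eq_mul]
      ring
    rw [h]
    exact ((gram_bound S fun i => f i a).hadamard
      ((posSemidef_prod f s).smul (by positivity))).add
      ((Matrix.posSemidef_gram ℝ _).hadamard ih)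

theorem form_nonneg (t : AlgTensorPower d H) : 0 ≤ form d H t t := by
  obtain ⟨n, c, f, rfl⟩ := exists_sum t
  rw [form_sum]
  exact (posSemidef_prod f Finset.univ).dotProduct_mulVec_nonneg c

/-- The (semi-)inner product data on the algebraic tensor product. -/
@[reducible]
def core (d : ℕ) (H : Type*) [NormedAddCommGroup H] [InnerProductSpace ℝ H] :
    PreInnerProductSpace.Core ℝ (AlgTensorPower d H) where
  inner s t := form d H s t
  conj_inner_symm s t := form_symm t s
  re_inner_nonneg t := form_nonneg t
  add_left s t u := by simp
  smul_left s t r := by simp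

instance : SeminormedAddCommGroup (AlgTensorPower d H) :=
  @InnerProductSpace.Core.toSeminormedAddCommGroup ℝ (AlgTensorPower d H) _ _ _ (core d H)

instance : InnerProductSpace ℝ (AlgTensorPower d H) :=
  InnerProductSpace.ofCore (core d H)

theorem inner_def (s t : AlgTensorPower d H) : inner ℝ s t = form d H s t := rfl

/-- The algebraic tensor power `S ⊗ ⋯ ⊗ S` of an operator. -/
def mapₗ (d : ℕ) (S : H →L[ℝ] G) : AlgTensorPower d H →ₗ[ℝ] AlgTensorPower d G :=
  PiTensorProduct.map (fun _ : Fin d => (S : H →ₗ[ℝ] G))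

theorem mapₗ_tprod (S : H →L[ℝ] G) (f : Fin d → H) :
    mapₗ d S (tprod d H f) = tprod d G (fun l => S (f l)) :=
  PiTensorProduct.map_tprod _ _

theorem norm_mapₗ_le (S : H →L[ℝ] G) (t : AlgTensorPower d H) :
    ‖mapₗ d S t‖ ≤ ‖S‖ ^ d * ‖t‖ := by
  refine le_of_sq_le_sq ?_ (by positivity)
  rw [mul_pow, ← real_inner_self_eq_norm_sq, ← real_inner_self_eq_norm_sq, inner_def, inner_def]
  obtain ⟨n, c, f, rfl⟩ := exists_sum t
  simp only [map_sum (mapₗ d S), map_smul (mapₗ d S), mapₗ_tprod]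
  rw [form_sum, form_sum]
  have h := (posSemidef_bound S f Finset.univ).dotProduct_mulVec_nonneg c
  have h1 : (Matrix.of fun i j => (∏ l, ‖S‖ ^ 2 * inner ℝ (f i l) (f j l)) -
      ∏ l, inner ℝ (S (f i l)) (S (f j l))) =
      (‖S‖ ^ d) ^ 2 • (Matrix.of fun i j => ∏ l, inner ℝ (f i l) (f j l)) -
      Matrix.of fun i j => ∏ l, inner ℝ (S (f i l)) (S (f j l)) := by
    ext i j
    simp [Finset.prod_mul_distrib, ← pow_mul, mul_comm]
  rw [h1, Matrix.sub_mulVec, dotProduct_sub, Matrix.smul_mulVec, dotProduct_smul,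
    smul_eq_mul, sub_nonneg] at h
  simpa using h

/-- The permutation of tensor factors `⊗ f_l ↦ ⊗ f_{π(l)}`. -/
def permₗ (H : Type*) [NormedAddCommGroup H] [InnerProductSpace ℝ H] (π : Equiv.Perm (Fin d)) :
    AlgTensorPower d H →ₗ[ℝ] AlgTensorPower d H :=
  (PiTensorProduct.reindex ℝ (fun _ : Fin d => H) π.symm).toLinearMap

theorem permₗ_tprod (π : Equiv.Perm (Fin d)) (f : Fin d → H) :
    permₗ H π (tprod d H f) = tprod d H (fun l => f (π l)) :=
  PiTensorProduct.reindex_tprod _ _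

theorem norm_permₗ (π : Equiv.Perm (Fin d)) (t : AlgTensorPower d H) : ‖permₗ H π t‖ = ‖t‖ := by
  have h : (form d H).compl₁₂ (permₗ H π) (permₗ H π) = form d H :=
    hom_ext fun f => hom_ext fun g => by
      simp only [LinearMap.compl₁₂_apply, permₗ_tprod, form_tprod]
      exact Equiv.prod_comp π fun l => inner ℝ (f l) (g l)
  have h2 : ‖permₗ H π t‖ ^ 2 = ‖t‖ ^ 2 := by
    rw [← real_inner_self_eq_norm_sq, ← real_inner_self_eq_norm_sq, inner_def, inner_def]
    exact congrArg (fun B => B t t) h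
  exact (sq_eq_sq₀ (norm_nonneg _) (norm_nonneg _)).1 h2

end AlgTensorPower

/-- The `d`-fold tensor product Hilbert space `H ⊗ ⋯ ⊗ H`: the completion of the algebraic tensor
product with respect to the inner product with `⟨⊗ f_l, ⊗ g_l⟩ = ∏ ⟨f_l, g_l⟩`. -/
abbrev HilbertTensorPower (d : ℕ) (H : Type*) [NormedAddCommGroup H] [InnerProductSpace ℝ H] :
    Type _ :=
  UniformSpace.Completion (AlgTensorPower d H)

section Operators

variable {d : ℕ} {H G : Type*} [NormedAddCommGroup H] [InnerProductSpace ℝ H]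
  [NormedAddCommGroup G] [InnerProductSpace ℝ G]

/-- The simple tensor `f 0 ⊗ ⋯ ⊗ f (d - 1)` in the tensor product Hilbert space. -/
def pureTensor (f : Fin d → H) : HilbertTensorPower d H :=
  ((AlgTensorPower.tprod d H f : AlgTensorPower d H) : HilbertTensorPower d H)

/-- The defining property of the inner product. -/
theorem inner_pureTensor (f g : Fin d → H) :
    inner ℝ (pureTensor f) (pureTensor g) = ∏ l, inner ℝ (f l) (g l) := by
  rw [pureTensor, pureTensor, UniformSpace.Completion.inner_coe, AlgTensorPower.inner_def,
    AlgTensorPower.form_tprod]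

/-- The tensor product operator `S_d = S ⊗ ⋯ ⊗ S`. -/
def tensorOp (d : ℕ) (S : H →L[ℝ] G) : HilbertTensorPower d H →L[ℝ] HilbertTensorPower d G :=
  ((AlgTensorPower.mapₗ d S).mkContinuous (‖S‖ ^ d)
    (AlgTensorPower.norm_mapₗ_le S)).completion

theorem tensorOp_pureTensor (S : H →L[ℝ] G) (f : Fin d → H) :
    tensorOp d S (pureTensor f) = pureTensor (fun l => S (f l)) := by
  simp [tensorOp, pureTensor, AlgTensorPower.mapₗ_tprod]

/-- The operator that permutes the tensor factors, `⊗ f_l ↦ ⊗ f_{π(l)}`. -/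
def permOp (H : Type*) [NormedAddCommGroup H] [InnerProductSpace ℝ H] (π : Equiv.Perm (Fin d)) :
    HilbertTensorPower d H →L[ℝ] HilbertTensorPower d H :=
  ((AlgTensorPower.permₗ H π).mkContinuous 1
    fun t => by rw [AlgTensorPower.norm_permₗ, one_mul]).completion

theorem permOp_pureTensor (π : Equiv.Perm (Fin d)) (f : Fin d → H) :
    permOp H π (pureTensor f) = pureTensor (fun l => f (π l)) := by
  simp [permOp, pureTensor, AlgTensorPower.permₗ_tprod]

/-- Continuous linear maps on the tensor product are determined by the simple tensors. -/
theorem tensor_hom_ext {E : Type*} [NormedAddCommGroup E] [NormedSpace ℝ E]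
    {φ ψ : HilbertTensorPower d H →L[ℝ] E}
    (h : ∀ f : Fin d → H, φ (pureTensor f) = ψ (pureTensor f)) : φ = ψ := by
  ext x
  induction x using UniformSpace.Completion.induction_on with
  | hp => exact isClosed_eq φ.continuous ψ.continuous
  | ih t =>
    obtain ⟨n, c, f, rfl⟩ := AlgTensorPower.exists_sum t
    have h1 : ((∑ i, c i • AlgTensorPower.tprod d H (f i) : AlgTensorPower d H) :
        HilbertTensorPower d H) = ∑ i, c i • pureTensor (f i) := by
      have := map_sum (UniformSpace.Completion.toComplL (𝕜 := ℝ) (E := AlgTensorPower d H))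
        (fun i => c i • AlgTensorPower.tprod d H (f i)) Finset.univ
      simp only [map_smul] at this
      exact this
    rw [h1]
    simp [h]

theorem permOp_comp (π σ : Equiv.Perm (Fin d)) :
    (permOp H π).comp (permOp H σ) = permOp H (σ * π) :=
  tensor_hom_ext fun f => by
    simp only [ContinuousLinearMap.comp_apply, permOp_pureTensor, Equiv.Perm.mul_apply]

end Operators

/-! ### (Anti-)symmetrizers and (anti-)symmetric subspaces -/

/-- The two kinds of symmetry conditions. -/
inductive SymmetryType
  | symmetric
  | antisymmetric

/-- The factor of a permutation: `1` in the symmetric case, the sign `(-1)^{|π|}` in the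
antisymmetric case. -/
def SymmetryType.factor {d : ℕ} : SymmetryType → Equiv.Perm (Fin d) → ℝ
  | .symmetric, _ => 1
  | .antisymmetric, π => ((Equiv.Perm.sign π : ℤ) : ℝ)

/-- The permutations of all coordinates that leave the complement of `I` pointwise fixed. -/
def permsOn {d : ℕ} (I : Finset (Fin d)) : Finset (Equiv.Perm (Fin d)) :=
  Finset.univ.filter fun π => ∀ i, i ∉ I → π i = i

section Symmetrizer

variable {d : ℕ} (s : SymmetryType) (I : Finset (Fin d)) (H : Type*) [NormedAddCommGroup H]
  [InnerProductSpace ℝ H]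

/-- The symmetrizer, or antisymmetrizer, with respect to the coordinates in `I`. -/
def symmetrizer : HilbertTensorPower d H →L[ℝ] HilbertTensorPower d H :=
  ((permsOn I).card : ℝ)⁻¹ • ∑ π ∈ permsOn I, s.factor π • permOp H π

theorem SymmetryType.factor_mul (π σ : Equiv.Perm (Fin d)) :
    s.factor (π * σ) = s.factor π * s.factor σ := by
  cases s <;> simp [SymmetryType.factor]

theorem symmetrizer_comp_self :
    (symmetrizer s I H).comp (symmetrizer s I H) = symmetrizer s I H := by
  have hone : (1 : Equiv.Perm (Fin d)) ∈ permsOn I := by simp [permsOn]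
  have hcard : ((permsOn I).card : ℝ) ≠ 0 := by
    exact_mod_cast (Finset.card_pos.2 ⟨_, hone⟩).ne'
  have hinner : ∀ π ∈ permsOn I,
      (∑ σ ∈ permsOn I, (s.factor π * s.factor σ) • (permOp H π).comp (permOp H σ)) =
        ∑ σ ∈ permsOn I, s.factor σ • permOp H σ := by
    intro π hπ
    simp only [permsOn, Finset.mem_filter, Finset.mem_univ, true_and] at hπ
    have hπ' : ∀ i, i ∉ I → π⁻¹ i = i := fun i hi => by
      rw [Equiv.Perm.inv_eq_iff_eq, hπ i hi]
    refine Finset.sum_bij' (fun σ _ => σ * π) (fun σ _ => σ * π⁻¹) ?_ ?_ ?_ ?_ ?_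
    · intro σ hσ
      simp only [permsOn, Finset.mem_filter, Finset.mem_univ, true_and] at hσ ⊢
      intro i hi
      rw [Equiv.Perm.mul_apply, hπ i hi, hσ i hi]
    · intro σ hσ
      simp only [permsOn, Finset.mem_filter, Finset.mem_univ, true_and] at hσ ⊢
      intro i hi
      rw [Equiv.Perm.mul_apply, hπ' i hi, hσ i hi]
    · intro σ _
      simp
    · intro σ _
      simp
    · intro σ _
      rw [permOp_comp, SymmetryType.factor_mul, mul_comm]
  have hsum : (∑ π ∈ permsOn I, s.factor π • permOp H π).comp
      (∑ π ∈ permsOn I, s.factor π • permOp H π) =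
      ((permsOn I).card : ℝ) • ∑ π ∈ permsOn I, s.factor π • permOp H π := by
    simp only [ContinuousLinearMap.finsetSum_comp, ContinuousLinearMap.comp_finsetSum,
      ContinuousLinearMap.smul_comp, ContinuousLinearMap.comp_smul, Finset.smul_sum, smul_smul]
    rw [Finset.sum_comm]
    simp only [mul_comm (s.factor _) (s.factor _)]
    rw [Finset.sum_congr rfl hinner, Finset.sum_const, ← Nat.cast_smul_eq_nsmul ℝ,
      Finset.smul_sum]
    simp only [smul_smul]
  unfold symmetrizer
  rw [ContinuousLinearMap.smul_comp, ContinuousLinearMap.comp_smul, hsum, smul_smul, smul_smul]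
  congr 1
  field_simp

/-- The subspace `P_I(H_d)` of `I`-symmetric, or `I`-antisymmetric, elements: the range of the
(anti-)symmetrizer. -/
def symSubspace : Submodule ℝ (HilbertTensorPower d H) :=
  LinearMap.range (symmetrizer s I H : HilbertTensorPower d H →ₗ[ℝ] HilbertTensorPower d H)

theorem isClosed_symSubspace :
    IsClosed (symSubspace s I H : Set (HilbertTensorPower d H)) := by
  have h : (symSubspace s I H : Set (HilbertTensorPower d H)) =
      {x | symmetrizer s I H x = x} := by
    ext x
    constructor
    · rintro ⟨y, rfl⟩
      exact congrArg (fun A => A y) (symmetrizer_comp_self s I H)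
    · intro hx
      exact ⟨x, hx⟩
  rw [h]
  exact isClosed_eq (symmetrizer s I H).continuous continuous_id

instance : CompleteSpace (symSubspace s I H) :=
  (isClosed_symSubspace s I H).completeSpace_coe

variable {H} {G : Type*} [NormedAddCommGroup G] [InnerProductSpace ℝ G]

/-- The restriction of `S_d = S ⊗ ⋯ ⊗ S` to the (anti-)symmetric subspace `P_I(H_d)`. -/
def symProblem (S : H →L[ℝ] G) : symSubspace s I H →L[ℝ] HilbertTensorPower d G :=
  (tensorOp d S).comp (symSubspace s I H).subtypeL

/-- The index set `∇_d`: multi-indices that are non-decreasing (symmetric case) or strictly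
increasing (antisymmetric case) along the coordinates in `I`. -/
def nabla : Set (Fin d → ℕ) :=
  match s with
  | .symmetric => {k | MonotoneOn k (I : Set (Fin d))}
  | .antisymmetric => {k | StrictMonoOn k (I : Set (Fin d))}

/-- `M_I(k)!`: the product, over the different integers `m` that occur in `k` among the coordinates
in `I`, of the factorial of the number of occurrences of `m` there. -/
def multFactorial (k : Fin d → ℕ) : ℕ :=
  ∏ m ∈ I.image k, (I.filter fun i => k i = m).card.factorial

/-- `ξ_k = √(#S_I / M_I(k)!) · P_I(e_{k_1} ⊗ ⋯ ⊗ e_{k_d})`, as an element of `P_I(H_d)`. -/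
def xi (e : ℕ → H) (k : Fin d → ℕ) : symSubspace s I H :=
  √(((permsOn I).card : ℝ) / (multFactorial I k : ℝ)) •
    ⟨symmetrizer s I H (pureTensor fun l => e (k l)), LinearMap.mem_range_self _ _⟩

/-- `λ_{d,k} = ∏ λ_{k_l}`. -/
def lamProd (lam : ℕ → ℝ) (k : Fin d → ℕ) : ℝ := ∏ l, lam (k l)

/-- The algorithm `A*_{n,d} f = ∑_{v=1}^n ⟨f, ξ_{ψ(v)}⟩ S_d ξ_{ψ(v)}` (here `v` starts at `0`). -/
def optAlgorithm (S : H →L[ℝ] G) (e : ℕ → H) (ψ : ℕ → Fin d → ℕ) (n : ℕ) :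
    symSubspace s I H → HilbertTensorPower d G := fun f =>
  ∑ v ∈ Finset.range n, inner ℝ f (xi s I e (ψ v)) • symProblem s I S (xi s I e (ψ v))

end Symmetrizer

/-- `(e i, lam i)`, `i ∈ ℕ`, are the eigenpairs of the positive semidefinite operator `W` in
non-increasing order: an orthonormal sequence of eigenvectors with non-increasing non-negative
eigenvalues that exhausts `W`, in the sense that `W` vanishes on the orthogonal complement (so that
every non-zero eigenvalue is listed with its full multiplicity). -/
structure IsEigenpairSequence {E : Type*} [NormedAddCommGroup E] [InnerProductSpace ℝ E]
    (W : E →L[ℝ] E) (e : ℕ → E) (lam : ℕ → ℝ) : Prop where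
  orthonormal : Orthonormal ℝ e
  eigen : ∀ i, W (e i) = lam i • e i
  antitone : Antitone lam
  nonneg : ∀ i, 0 ≤ lam i
  exhausts : ∀ x, (∀ i, inner ℝ (e i) x = 0) → W x = 0

/-! ### Algorithms and errors -/

section Algorithms

variable {F Y : Type*} [NormedAddCommGroup F] [NormedSpace ℝ F] [NormedAddCommGroup Y]
  [NormedSpace ℝ Y]

/-- Linear non-adaptive algorithms `f ↦ ∑ L_v(f) g_v` using `n` continuous linear functionals. -/
def linAlgorithms (F Y : Type*) [NormedAddCommGroup F] [NormedSpace ℝ F] [NormedAddCommGroup Y]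
    [NormedSpace ℝ Y] (n : ℕ) : Set (F → Y) :=
  {A | ∃ (L : Fin n → F →L[ℝ] ℝ) (g : Fin n → Y), ∀ f, A f = ∑ v, L v f • g v}

/-- Algorithms `φ ∘ N` with arbitrary `φ` and non-adaptive information `N` consisting of `n`
continuous, not necessarily linear, functionals. -/
def contAlgorithms (F Y : Type*) [NormedAddCommGroup F] (n : ℕ) : Set (F → Y) :=
  {A | ∃ (L : Fin n → F → ℝ) (φ : (Fin n → ℝ) → Y), (∀ v, Continuous (L v)) ∧
    ∀ f, A f = φ fun v => L v f}

/-- Algorithms `φ ∘ N` with arbitrary `φ` and adaptive information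
`N(f) = (y_1, …, y_n)`, `y_v = L_v(f; y_1, …, y_{v-1})`, where every
`L_v(· ; y_1, …, y_{v-1})` is a continuous linear functional. -/
def adaptAlgorithms (F Y : Type*) [NormedAddCommGroup F] [NormedSpace ℝ F] (n : ℕ) :
    Set (F → Y) :=
  {A | ∃ (L : (v : Fin n) → (Fin v → ℝ) → F →L[ℝ] ℝ) (N : F → Fin n → ℝ)
      (φ : (Fin n → ℝ) → Y),
    (∀ f v, N f v = L v (fun j : Fin v => N f (Fin.castLE v.isLt.le j)) f) ∧
    ∀ f, A f = φ (N f)}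

/-- The worst case error of `A` for `S` over the closed unit ball; it may be infinite. -/
def worstCaseError (S A : F → Y) : ENNReal :=
  ⨆ f ∈ Metric.closedBall (0 : F) 1, ENNReal.ofReal ‖A f - S f‖

/-- The minimal worst case error over a class of algorithms. -/
def minimalError (S : F → Y) (𝒜 : Set (F → Y)) : ENNReal :=
  ⨅ A ∈ 𝒜, worstCaseError S A

end Algorithms

end

/-!
The family `ξ` is orthonormal because `⟪P_I e_j, P_I e_k⟫` is `(#S_I)⁻¹` times the sum of `ε(π)`
over the `π ∈ S_I` with `j ∘ π = k`: for `j, k ∈ ∇_d` this sum is empty unless `j = k`, and then all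
its `M_I(k)!` terms are `1`. It exhausts `W_d` on `P_I(H_d)` because every multi-index can be sorted
along `I`, and a sorted multi-index outside `∇_d` is stabilized by a permutation with `ε(π) ≠ 1`, so
that its (anti-)symmetrization vanishes.

The worst case error of `A*_{n,d}` is read off the eigenvector expansion
`‖S f‖² = ∑_v λ_v ⟪f, ξ_v⟫²`. For the lower bound let `V` be the span of the first `n + 1`
eigenvectors, where `‖S f‖ ≥ √λ_n ‖f‖`. Adaptive linear information vanishes at `f` and `-f` for
some unit vector `f ∈ V`, so the algorithm errs by at least `‖S f‖` at one of them. For continuous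
information, an error less than `√λ_n` would reconstruct the points of the unit ball of `V` from `n`
continuous real functions up to an error `r < 1`. The reconstruction `ℝⁿ → V` can be taken to be
`C¹`. Since the unit ball has no `C¹` retraction onto its sphere, the image of the reconstruction
then contains a ball, which is impossible for the `C¹` image of a space of smaller dimension.
-/

section Degree

open MeasureTheory Metric Polynomial Topology

variable {E : Type*} [NormedAddCommGroup E]

theorem injective_id_add_of_lipschitzWith {c : NNReal} (hc : c < 1) {u : E → E}
    (hu : LipschitzWith c u) : Function.Injective fun x => x + u x :=
  (AntilipschitzWith.id.add_lipschitzWith hu (by simpa using hc)).injective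

theorem image_id_add_eq_of_lipschitzWith [CompleteSpace E] {c : NNReal} (hc : c < 1) {u : E → E}
    (hu : LipschitzWith c u) {K : Set E} (hK : ∀ x ∉ K, u x = 0) :
    (fun x => x + u x) '' K = K := by
  have hsurj (y : E) : ∃ x, x + u x = y := by
    have hcontr : ContractingWith c fun x => y - u x :=
      ⟨hc, by simpa using (LipschitzWith.const y).sub hu⟩
    exact ⟨_, eq_sub_iff_add_eq.1 hcontr.fixedPoint_isFixedPt.symm⟩
  refine Set.Subset.antisymm ?_ fun y hy => ?_
  · rintro _ ⟨x, hx, rfl⟩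
    by_contra hout
    have hfix := injective_id_add_of_lipschitzWith hc hu
      (show (x + u x) + u (x + u x) = x + u x by rw [hK _ hout, add_zero])
    exact hout (by simpa only [hfix] using hx)
  · obtain ⟨x, rfl⟩ := hsurj y
    refine ⟨x, ?_, rfl⟩
    by_contra hx
    exact hx (by simpa only [hK x hx, add_zero] using hy)

theorem nonempty_inter_frontier_of_isPreconnected {X : Type*} [TopologicalSpace X] {s K : Set X}
    (hs : IsPreconnected s) (hK : IsClosed K) (hin : (s ∩ K).Nonempty) (hout : (s \ K).Nonempty) :
    (s ∩ frontier K).Nonempty := by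
  by_contra! hempty
  have hint : s ∩ K ⊆ interior K := fun x hx => by
    by_contra hxi
    exact Set.notMem_empty x (hempty ▸ ⟨hx.1, subset_closure hx.2, hxi⟩)
  obtain ⟨x, -, hx, hx'⟩ := hs (interior K) Kᶜ isOpen_interior hK.isOpen_compl
    (fun x hx => (em (x ∈ K)).imp (fun h => hint ⟨hx, h⟩) id)
    (hin.mono fun x hx => ⟨hx.1, hint hx⟩) hout
  exact hx' (interior_subset hx)

theorem lipschitzWith_indicator [NormedSpace ℝ E] {F : Type*} [NormedAddCommGroup F] {C : NNReal}
    {u : E → F} {K : Set E} (hK : IsClosed K) (hu : LipschitzOnWith C u K)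
    (hu0 : ∀ x ∈ frontier K, u x = 0) : LipschitzWith C (K.indicator u) := by
  have hmixed (x y : E) (hx : x ∈ K) (hy : y ∉ K) : ‖u x‖ ≤ C * ‖x - y‖ := by
    obtain ⟨z, hz, hzf⟩ := nonempty_inter_frontier_of_isPreconnected
      (convex_segment x y).isPreconnected hK ⟨x, left_mem_segment ℝ x y, hx⟩
      ⟨y, right_mem_segment ℝ x y, hy⟩
    have hxz := hu.norm_sub_le hx (hK.frontier_subset hzf)
    rw [hu0 z hzf, sub_zero] at hxz
    have hdist := dist_add_dist_of_mem_segment hz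
    rw [dist_eq_norm, dist_eq_norm, dist_eq_norm] at hdist
    refine hxz.trans ?_
    gcongr
    linarith [norm_nonneg (z - y)]
  refine lipschitzWith_iff_norm_sub_le.2 fun x y => ?_
  by_cases hx : x ∈ K <;> by_cases hy : y ∈ K
  · simpa only [Set.indicator_of_mem hx, Set.indicator_of_mem hy] using hu.norm_sub_le hx hy
  · simpa only [Set.indicator_of_mem hx, Set.indicator_of_notMem hy, sub_zero]
      using hmixed x y hx hy
  · simpa only [Set.indicator_of_notMem hx, Set.indicator_of_mem hy, zero_sub, norm_neg,
      norm_sub_rev x y] using hmixed y x hy hx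
  · simp only [Set.indicator_of_notMem hx, Set.indicator_of_notMem hy, sub_zero, norm_zero]
    positivity

variable [NormedSpace ℝ E]

theorem eventually_det_one_add_smul_pos {X : Type*} [TopologicalSpace X] {K : Set X}
    (hK : IsCompact K) {A : X → E →L[ℝ] E} (hA : Continuous A) :
    ∀ᶠ t : ℝ in 𝓝 0, ∀ x ∈ K, 0 < (1 + t • A x).det := by
  refine hK.eventually_forall_of_forall_eventually fun x _ => ?_
  have hcont : Continuous fun z : ℝ × X => (1 + z.1 • A z.2).det :=
    ContinuousLinearMap.continuous_det.comp (by fun_prop)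
  exact hcont.continuousAt.eventually_const_lt (by simp [ContinuousLinearMap.det])

variable [FiniteDimensional ℝ E]

theorem exists_polynomial_eval_eq_det (A B : E →L[ℝ] E) :
    ∃ p : ℝ[X], p.natDegree ≤ Module.finrank ℝ E ∧ ∀ t : ℝ, (B + t • A).det = p.eval t := by
  let b := Module.finBasis ℝ E
  let a := LinearMap.toMatrix b b A
  let c := LinearMap.toMatrix b b B
  refine ⟨((X : ℝ[X]) • a.map C + c.map C).det, ?_, fun t => ?_⟩
  · simpa using natDegree_det_X_add_C_le a c
  · rw [← coe_evalRingHom, RingHom.map_det, ContinuousLinearMap.det, ← LinearMap.det_toMatrix b]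
    congr 1
    ext i j
    simp only [a, c, ContinuousLinearMap.toLinearMap_add, ContinuousLinearMap.toLinearMap_smul,
      map_add, map_smul, Matrix.add_apply, Matrix.smul_apply, smul_eq_mul,
      RingHom.mapMatrix_apply, coe_evalRingHom, Matrix.map_apply, eval_mul, eval_X,
      eval_C]
    ring

theorem exists_polynomial_eval_eq_integral {X : Type*} [MeasurableSpace X] {μ : Measure X}
    {n : ℕ} {f : X → ℝ → ℝ} (hf : ∀ x, ∃ p : ℝ[X], p.natDegree ≤ n ∧ ∀ t, f x t = p.eval t)
    (hint : ∀ t, Integrable (f · t) μ) :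
    ∃ p : ℝ[X], ∀ t, ∫ x, f x t ∂μ = p.eval t := by
  let v : ℕ → ℝ := fun i => i
  let s := Finset.range (n + 1)
  have hv : Set.InjOn v s := Nat.cast_injective.injOn
  have hinterp (x : X) (t : ℝ) : f x t = ∑ i ∈ s, f x (v i) * (Lagrange.basis s v i).eval t := by
    obtain ⟨p, hp, hfp⟩ := hf x
    have hdeg : p.degree < (s.card : WithBot ℕ) := by
      rw [Finset.card_range]
      exact degree_le_natDegree.trans_lt (by exact_mod_cast Nat.lt_succ_of_le hp)
    simp only [hfp]
    conv_lhs => rw [Lagrange.eq_interpolate hv hdeg]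
    simp [Lagrange.interpolate_apply, eval_finsetSum]
  refine ⟨∑ i ∈ s, C (∫ x, f x (v i) ∂μ) * Lagrange.basis s v i, fun t => ?_⟩
  simp only [hinterp _ t, eval_finsetSum, eval_mul, eval_C]
  rw [integral_finsetSum _ fun i _ => (hint (v i)).mul_const _]
  simp only [integral_mul_const]

variable [MeasurableSpace E] [BorelSpace E] (μ : Measure E) [μ.IsAddHaarMeasure]

theorem eventually_setIntegral_det_one_add_smul_fderiv {K : Set E} (hK : IsCompact K)
    (hKc : Convex ℝ K) {h : E → E} (hh : ContDiff ℝ 1 h) (h0 : ∀ x ∈ frontier K, h x = 0) :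
    ∀ᶠ t : ℝ in 𝓝 0, ∫ x in K, (1 + t • fderiv ℝ h x).det ∂μ = μ.real K := by
  obtain ⟨C, hC⟩ := hh.contDiffOn.exists_lipschitzOnWith one_ne_zero hKc hK
  have hsmall : ∀ᶠ t : ℝ in 𝓝 0, ‖t‖₊ * C < 1 :=
    (show Continuous fun t : ℝ => ‖t‖₊ * C by fun_prop).continuousAt.eventually_lt_const (by simp)
  filter_upwards [hsmall, eventually_det_one_add_smul_pos hK (hh.continuous_fderiv one_ne_zero)]
    with t ht hpos
  let u := K.indicator fun x => t • h x
  have hu : LipschitzWith (‖t‖₊ * C) u :=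
    lipschitzWith_indicator hK.isClosed ((lipschitzWith_smul t).comp_lipschitzOnWith hC)
      fun x hx => by rw [h0 x hx, smul_zero]
  have huK : Set.EqOn (fun x => x + u x) (fun x => x + t • h x) K := fun x hx => by
    simp only [u, Set.indicator_of_mem hx]
  have himage : (fun x => x + t • h x) '' K = K := by
    rw [← huK.image_eq]
    exact image_id_add_eq_of_lipschitzWith ht hu fun x hx => Set.indicator_of_notMem hx _
  have hinj : Set.InjOn (fun x => x + t • h x) K :=
    huK.injOn_iff.1 (injective_id_add_of_lipschitzWith ht hu).injOn
  have hderiv (x : E) : HasFDerivAt (fun x => x + t • h x) (1 + t • fderiv ℝ h x) x :=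
    (hasFDerivAt_id x).add ((hh.differentiable one_ne_zero x).hasFDerivAt.const_smul t)
  have hchange := integral_image_eq_integral_abs_det_fderiv_smul μ hK.measurableSet
    (fun x _ => (hderiv x).hasFDerivWithinAt) hinj fun _ => (1 : ℝ)
  rw [himage, setIntegral_const, smul_eq_mul, mul_one] at hchange
  rw [hchange]
  exact setIntegral_congr_fun hK.measurableSet fun x hx => by
    simp only [smul_eq_mul, mul_one, abs_of_pos (hpos x hx)]

/-- The integral of `det (1 + t • fderiv ℝ h x)` is a polynomial in `t`, so being constant for
small `t` it is constant. -/
theorem setIntegral_det_fderiv_eq_of_eqOn_frontier {K : Set E} (hK : IsCompact K)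
    (hKc : Convex ℝ K) {f : E → E} (hf : ContDiff ℝ 1 f) (hfK : Set.EqOn f id (frontier K)) :
    ∫ x in K, (fderiv ℝ f x).det ∂μ = μ.real K := by
  let h : E → E := fun x => f x - x
  have hh : ContDiff ℝ 1 h := hf.sub contDiff_id
  have hcont (t : ℝ) : Continuous fun x => (1 + t • fderiv ℝ h x).det :=
    ContinuousLinearMap.continuous_det.comp
      (continuous_const.add ((hh.continuous_fderiv one_ne_zero).const_smul t))
  obtain ⟨p, hp⟩ := exists_polynomial_eval_eq_integral (μ := μ.restrict K)
    (fun x => exists_polynomial_eval_eq_det (fderiv ℝ h x) 1)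
    fun t => (hcont t).continuousOn.integrableOn_compact hK
  have hconst : p = C (μ.real K) := by
    refine eq_of_infinite_eval_eq _ _ (infinite_of_mem_nhds 0 ?_)
    filter_upwards [eventually_setIntegral_det_one_add_smul_fderiv μ hK hKc hh
      fun x hx => sub_eq_zero.2 (hfK hx)] with t ht
    rw [eval_C, ← ht, hp]
  have hfderiv (x : E) : fderiv ℝ f x = 1 + (1 : ℝ) • fderiv ℝ h x := by
    rw [one_smul, fderiv_fun_sub (hf.differentiable one_ne_zero x) differentiableAt_fun_id,
      fderiv_fun_id, ContinuousLinearMap.one_def, add_sub_cancel]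
  simp only [hfderiv, hp, hconst, eval_C]

end Degree

section Surjectivity

open MeasureTheory Metric Topology

variable {E : Type*} [NormedAddCommGroup E] [InnerProductSpace ℝ E] [FiniteDimensional ℝ E]

theorem det_fderiv_eq_zero_of_norm_eq_one {F : E → E} (hF : Differentiable ℝ F)
    (hnorm : ∀ x, ‖F x‖ = 1) (x : E) : (fderiv ℝ F x).det = 0 := by
  have horth (v : E) : inner ℝ (F x) (fderiv ℝ F x v) = 0 := by
    have hconst : (fun y => inner ℝ (F y) (F y)) = fun _ => (1 : ℝ) := funext fun y => by
      rw [real_inner_self_eq_norm_sq, hnorm, one_pow]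
    have hderiv := fderiv_inner_apply ℝ (hF x) (hF x) v
    rw [hconst, fderiv_const_apply, zero_apply,
      real_inner_comm (F x) (fderiv ℝ F x v)] at hderiv
    linarith
  by_contra hdet
  obtain ⟨v, hv⟩ : ∃ v, fderiv ℝ F x v = F x :=
    ((fderiv ℝ F x).toContinuousLinearEquivOfDetNeZero hdet).surjective (F x)
  have hself := horth v
  rw [hv, real_inner_self_eq_norm_sq, hnorm] at hself
  norm_num at hself

theorem exists_norm_ne_one_of_eqOn_sphere {F : E → E} (hF : ContDiff ℝ 1 F)
    (hFS : Set.EqOn F id (sphere 0 1)) : ∃ x, ‖F x‖ ≠ 1 := by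
  by_contra! hnorm
  let _ : MeasurableSpace E := borel E
  have _ : BorelSpace E := ⟨rfl⟩
  have hint := setIntegral_det_fderiv_eq_of_eqOn_frontier (Measure.addHaar : Measure E)
    (isCompact_closedBall 0 1) (convex_closedBall 0 1) hF
    (by rwa [frontier_closedBall _ one_ne_zero])
  simp only [det_fderiv_eq_zero_of_norm_eq_one (hF.differentiable one_ne_zero) hnorm,
    integral_zero] at hint
  exact (ENNReal.toReal_pos (measure_closedBall_pos _ 0 one_pos).ne'
    measure_closedBall_lt_top.ne).ne hint

theorem exists_eq_zero_of_contDiff {g : E → E} (hg : ContDiff ℝ 1 g) {r : ℝ} (hr : r < 1)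
    (hgr : ∀ x ∈ closedBall (0 : E) 1, ‖g x - x‖ ≤ r) : ∃ x ∈ closedBall (0 : E) 1, g x = 0 := by
  by_contra! hg0
  have hr0 : 0 ≤ r := (norm_nonneg _).trans (hgr 0 (mem_closedBall_self zero_le_one))
  obtain ⟨ρ, hrρ, hρ⟩ := exists_between hr
  let χ : ContDiffBump (0 : E) := ⟨ρ, 1, hr0.trans_lt hrρ, hρ⟩
  let f : E → E := fun x => x + χ x • (g x - x)
  have hf : ContDiff ℝ 1 f :=
    contDiff_id.add (χ.contDiff.smul (hg.sub contDiff_id))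
  have hfar {x : E} (hx : 1 ≤ ‖x‖) : f x = x := by
    simp only [f, χ.zero_of_le_dist (by rwa [dist_zero_right]), zero_smul, add_zero]
  have hf0 (x : E) : f x ≠ 0 := by
    rcases le_or_gt ‖x‖ ρ with hx | hx
    · have hball : x ∈ closedBall (0 : E) 1 := mem_closedBall_zero_iff.2 (hx.trans hρ.le)
      simpa only [f, χ.one_of_mem_closedBall (mem_closedBall_zero_iff.2 hx), one_smul,
        add_sub_cancel] using hg0 x hball
    rcases le_or_gt 1 ‖x‖ with hx1 | hx1
    · rw [hfar hx1]
      exact norm_pos_iff.1 (zero_lt_one.trans_le hx1)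
    · have hχ : ‖χ x • (g x - x)‖ ≤ r := by
        rw [norm_smul, Real.norm_of_nonneg χ.nonneg]
        exact (mul_le_of_le_one_left (norm_nonneg _) χ.le_one).trans
          (hgr x (mem_closedBall_zero_iff.2 hx1.le))
      refine norm_pos_iff.1 ?_
      linarith [norm_sub_le_norm_add x (χ x • (g x - x))]
  obtain ⟨x, hx⟩ := exists_norm_ne_one_of_eqOn_sphere (F := fun x => ‖f x‖⁻¹ • f x)
    (((hf.norm ℝ hf0).inv fun x => norm_ne_zero_iff.2 (hf0 x)).smul hf) fun x hx => by
      have hx1 : ‖x‖ = 1 := mem_sphere_zero_iff_norm.1 hx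
      simp only [hfar hx1.ge, hx1, inv_one, one_smul, id]
  exact hx (norm_smul_inv_norm (𝕜 := ℝ) (hf0 x))

theorem exists_eq_zero_of_continuous {g : E → E} (hg : Continuous g) {r : ℝ} (hr : r < 1)
    (hgr : ∀ x ∈ closedBall (0 : E) 1, ‖g x - x‖ ≤ r) : ∃ x ∈ closedBall (0 : E) 1, g x = 0 := by
  obtain ⟨x₀, hx₀, hmin⟩ := (isCompact_closedBall (0 : E) 1).exists_isMinOn
    (nonempty_closedBall.2 zero_le_one) hg.norm.continuousOn
  by_contra! hg0
  let ε := min ‖g x₀‖ ((1 - r) / 2)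
  have hε : 0 < ε := lt_min (norm_pos_iff.2 (hg0 x₀ hx₀)) (by linarith)
  obtain ⟨g₁, hg₁, hclose, -⟩ := hg.exists_contDiff_approx 1 (ε := fun _ => ε)
    continuous_const fun _ => hε
  simp only [dist_eq_norm] at hclose
  obtain ⟨x, hx, hx0⟩ := exists_eq_zero_of_contDiff (r := ε + r) hg₁
    (by linarith [min_le_right ‖g x₀‖ ((1 - r) / 2)]) fun x hx => by
      linarith [norm_sub_le_norm_sub_add_norm_sub (g₁ x) (g x) x, hclose x, hgr x hx]
  have hlt : ‖g x‖ < ε := by simpa only [hx0, zero_sub, norm_neg] using hclose x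
  exact (hlt.trans_le (min_le_left _ _)).not_ge (hmin hx)

theorem ball_subset_image_of_norm_sub_le {g : E → E} (hg : Continuous g) {r : ℝ}
    (hgr : ∀ x ∈ closedBall (0 : E) 1, ‖g x - x‖ ≤ r) : ball 0 (1 - r) ⊆ g '' closedBall 0 1 := by
  intro y hy
  rw [mem_ball_zero_iff] at hy
  obtain ⟨x, hx, hxy⟩ := exists_eq_zero_of_continuous (r := r + ‖y‖) (hg.sub continuous_const)
    (by linarith) fun x hx => by
      rw [Pi.sub_apply, sub_right_comm]
      exact (norm_sub_le _ _).trans (by gcongr; exact hgr x hx)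
  exact ⟨x, hx, sub_eq_zero.1 hxy⟩

theorem exists_contDiff_norm_comp_sub_lt {Z : Type*} [NormedAddCommGroup Z] [NormedSpace ℝ Z]
    [FiniteDimensional ℝ Z] {F : Type*} [NormedAddCommGroup F] [NormedSpace ℝ F] {K : Set F}
    (hK : IsCompact K) {N : F → Z} (hN : Continuous N) {φ : Z → F} {r : ℝ}
    (hφ : ∀ x ∈ K, ‖φ (N x) - x‖ < r) :
    ∃ ψ : Z → F, ContDiff ℝ 1 ψ ∧ ∀ x ∈ K, ‖ψ (N x) - x‖ < r := by
  obtain ⟨ψ, hψ⟩ := exists_contMDiffMap_forall_mem_convex_of_local_const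
    (n := 1) (modelWithCornersSelf ℝ Z) (t := fun z => {c | ∀ x ∈ K, N x = z → c ∈ ball x r})
    (fun z c hc c' hc' a b ha hb hab x hx hxz =>
      convex_ball x r (hc x hx hxz) (hc' x hx hxz) ha hb hab)
    (fun z => by
      refine ⟨φ z, ?_⟩
      have hclosed : IsClosed (N '' (K ∩ {x | r ≤ ‖φ z - x‖})) :=
        ((hK.inter_right (isClosed_le continuous_const (by fun_prop))).image hN).isClosed
      have hz : z ∉ N '' (K ∩ {x | r ≤ ‖φ z - x‖}) := by
        rintro ⟨x, ⟨hx, hx'⟩, rfl⟩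
        exact (hφ x hx).not_ge hx'
      filter_upwards [hclosed.isOpen_compl.mem_nhds hz] with z' hz' x hx hxz'
      rw [mem_ball, dist_eq_norm]
      by_contra! hle
      exact hz' ⟨x, ⟨hx, hle⟩, hxz'⟩)
  exact ⟨ψ, ψ.contMDiff.contDiff, fun x hx => by simpa [dist_eq_norm] using hψ (N x) x hx rfl⟩

theorem exists_lt_norm_sub_of_continuous {Z : Type*} [NormedAddCommGroup Z] [NormedSpace ℝ Z]
    [FiniteDimensional ℝ Z] (hZ : Module.finrank ℝ Z < Module.finrank ℝ E) {N : E → Z}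
    (hN : Continuous N) (φ : Z → E) {r : ℝ} (hr : r < 1) :
    ∃ x ∈ closedBall (0 : E) 1, r < ‖φ (N x) - x‖ := by
  by_contra! hφ
  obtain ⟨r₁, hr₁, hr₁'⟩ := exists_between hr
  obtain ⟨ψ, hψ, hψN⟩ := exists_contDiff_norm_comp_sub_lt (isCompact_closedBall (0 : E) 1) hN
    fun x hx => (hφ x hx).trans_lt hr₁
  have hball : ball 0 (1 - r₁) ⊆ Set.range ψ :=
    (ball_subset_image_of_norm_sub_le (hψ.continuous.comp hN) fun x hx => (hψN x hx).le).trans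
      ((Set.image_subset_range _ _).trans (Set.range_comp_subset_range _ _))
  obtain ⟨y, hyball, hy⟩ := (hψ.dense_compl_range_of_finrank_lt_finrank hZ).inter_open_nonempty _
    isOpen_ball (nonempty_ball.2 (sub_pos.2 hr₁'))
  exact hy (hball hyball)

end Surjectivity

section LowerBounds

open Metric

theorem ofReal_norm_sub_le_worstCaseError {F Y : Type*} [NormedAddCommGroup F]
    [NormedAddCommGroup Y] {S A : F → Y} {f : F} (hf : f ∈ closedBall (0 : F) 1) :
    ENNReal.ofReal ‖A f - S f‖ ≤ worstCaseError S A :=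
  le_iSup₂ (f := fun f (_ : f ∈ closedBall (0 : F) 1) => ENNReal.ofReal ‖A f - S f‖) f hf

section Adaptive

variable {F Y : Type*} [NormedAddCommGroup F] [NormedSpace ℝ F]

theorem adaptiveInformation_eq_zero {n : ℕ} {L : (v : Fin n) → (Fin v → ℝ) → F →L[ℝ] ℝ}
    {N : F → Fin n → ℝ} (hN : ∀ f v, N f v = L v (fun j : Fin v => N f (Fin.castLE v.isLt.le j)) f)
    {f : F} (hf : ∀ v, L v 0 f = 0) : N f = 0 := by
  have hvalue (m : ℕ) (hm : m < n) : N f ⟨m, hm⟩ = 0 := by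
    induction m using Nat.strong_induction_on with
    | _ m ih =>
      have hprev : (fun j : Fin m => N f (Fin.castLE hm.le j)) = 0 :=
        funext fun j => ih j j.isLt (j.isLt.trans hm)
      rw [hN f ⟨m, hm⟩, hprev]
      exact hf ⟨m, hm⟩
  exact funext fun v => hvalue v v.isLt

theorem exists_norm_eq_one_forall_apply_eq_zero {n : ℕ} {V : Submodule ℝ F}
    (hV : n < Module.finrank ℝ V) (ℓ : Fin n → F →L[ℝ] ℝ) :
    ∃ f ∈ V, ‖f‖ = 1 ∧ ∀ v, ℓ v f = 0 := by
  have : FiniteDimensional ℝ V := .of_finrank_pos (n.zero_le.trans_lt hV)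
  let L : V →ₗ[ℝ] Fin n → ℝ := LinearMap.pi fun v => (ℓ v).toLinearMap ∘ₗ V.subtype
  obtain ⟨g, hgL, hg0⟩ := Submodule.exists_mem_ne_zero_of_ne_bot
    (LinearMap.ker_ne_bot_of_finrank_lt (f := L) (by simpa using hV))
  refine ⟨‖g‖⁻¹ • g, V.smul_mem _ g.2, norm_smul_inv_norm (𝕜 := ℝ) (by simpa using hg0),
    fun v => ?_⟩
  have hgv : ℓ v (g : F) = 0 := congrFun hgL v
  rw [map_smul, hgv, smul_zero]

variable [NormedAddCommGroup Y] [NormedSpace ℝ Y]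

/-- Some unit vector of `V` and its negative produce the same, zero, information. -/
theorem ofReal_le_worstCaseError_of_mem_adaptAlgorithms {n : ℕ} {T : F →ₗ[ℝ] Y}
    {V : Submodule ℝ F} (hV : n < Module.finrank ℝ V) {c : ℝ} (hc : ∀ f ∈ V, c * ‖f‖ ≤ ‖T f‖)
    {A : F → Y} (hA : A ∈ adaptAlgorithms F Y n) : ENNReal.ofReal c ≤ worstCaseError T A := by
  obtain ⟨L, N, φ, hN, hAφ⟩ := hA
  obtain ⟨f, hfV, hnorm, hLf⟩ := exists_norm_eq_one_forall_apply_eq_zero hV fun v => L v 0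
  have hfN : N f = 0 := adaptiveInformation_eq_zero hN hLf
  have hnegN : N (-f) = 0 :=
    adaptiveInformation_eq_zero hN fun v => by rw [map_neg, hLf, neg_zero]
  have hpos := ofReal_norm_sub_le_worstCaseError (S := T) (A := A) (f := f)
    (mem_closedBall_zero_iff.2 hnorm.le)
  have hneg := ofReal_norm_sub_le_worstCaseError (S := T) (A := A) (f := -f)
    (mem_closedBall_zero_iff.2 (by rw [norm_neg, hnorm]))
  rw [hAφ, hfN] at hpos
  rw [hAφ, hnegN, map_neg, sub_neg_eq_add] at hneg
  have hcf : c ≤ ‖T f‖ := by simpa only [hnorm, mul_one] using hc f hfV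
  have htwo : 2 * ‖T f‖ ≤ ‖φ 0 + T f‖ + ‖φ 0 - T f‖ := by
    have hsum := norm_sub_le (φ 0 + T f) (φ 0 - T f)
    rwa [add_sub_sub_cancel, ← two_smul ℝ, norm_smul, Real.norm_two] at hsum
  rcases le_total ‖φ 0 - T f‖ ‖φ 0 + T f‖ with hle | hle
  · exact (ENNReal.ofReal_le_ofReal (by linarith)).trans hneg
  · exact (ENNReal.ofReal_le_ofReal (by linarith)).trans hpos

end Adaptive

section Continuous

variable {F Y : Type*} [NormedAddCommGroup F] [NormedAddCommGroup Y] [InnerProductSpace ℝ Y]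

theorem exists_mul_norm_sub_le [NormedSpace ℝ F] [FiniteDimensional ℝ F] {T : F →ₗ[ℝ] Y} {c : ℝ}
    (hc : 0 < c) (hT : ∀ f, c * ‖f‖ ≤ ‖T f‖) : ∃ R : Y → F, ∀ y f, c * ‖R y - f‖ ≤ ‖y - T f‖ := by
  have hinj : Function.Injective T := (injective_iff_map_eq_zero T).2 fun f hf => by
    have hle := hT f
    rw [hf, norm_zero] at hle
    exact norm_le_zero_iff.1 (nonpos_of_mul_nonpos_right hle hc)
  let P : Y →L[ℝ] LinearMap.range T := (LinearMap.range T).orthogonalProjectionOnto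
  let R : Y → F := fun y => (LinearEquiv.ofInjective T hinj).symm (P y)
  have hTR (y : Y) : T (R y) = P y :=
    congrArg Subtype.val ((LinearEquiv.ofInjective T hinj).apply_symm_apply (P y))
  refine ⟨R, fun y f => ?_⟩
  have hproj : T (R y - f) = P (y - T f) := by
    have hPT : P (T f) = ⟨T f, LinearMap.mem_range_self T f⟩ :=
      Submodule.orthogonalProjectionOnto_mem_subspace_eq_self ⟨T f, LinearMap.mem_range_self T f⟩
    rw [map_sub, hTR, map_sub, hPT, Submodule.coe_sub]
  calc c * ‖R y - f‖ ≤ ‖T (R y - f)‖ := hT _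
    _ = ‖P (y - T f)‖ := by rw [hproj, Submodule.coe_norm]
    _ ≤ ‖y - T f‖ := Submodule.norm_orthogonalProjectionOnto_apply_le _ _

theorem ofReal_le_worstCaseError_of_mem_contAlgorithms [InnerProductSpace ℝ F] {n : ℕ}
    {T : F →ₗ[ℝ] Y} {V : Submodule ℝ F} (hV : n < Module.finrank ℝ V) {c : ℝ}
    (hc : ∀ f ∈ V, c * ‖f‖ ≤ ‖T f‖) {A : F → Y} (hA : A ∈ contAlgorithms F Y n) :
    ENNReal.ofReal c ≤ worstCaseError T A := by
  obtain ⟨L, φ, hL, hAφ⟩ := hA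
  have : FiniteDimensional ℝ V := .of_finrank_pos (n.zero_le.trans_lt hV)
  rcases le_or_gt c 0 with hc0 | hc0
  · rw [ENNReal.ofReal_of_nonpos hc0]
    exact zero_le
  obtain ⟨R, hR⟩ := exists_mul_norm_sub_le (T := T ∘ₗ V.subtype) hc0 fun f => hc f f.2
  by_contra! hlt
  obtain ⟨a, -, hea, hac⟩ := ENNReal.lt_iff_exists_real_btwn.1 hlt
  have hac : a < c := (ENNReal.ofReal_lt_ofReal_iff hc0).1 hac
  obtain ⟨f, hf, hfa⟩ := exists_lt_norm_sub_of_continuous (N := fun (f : V) v => L v f)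
    (by simpa using hV) (by fun_prop) (R ∘ φ) ((div_lt_one hc0).2 hac)
  refine hea.not_ge (le_trans (ENNReal.ofReal_le_ofReal ?_)
    (ofReal_norm_sub_le_worstCaseError (f := (f : F)) (by simpa using hf)))
  calc a ≤ c * ‖(R ∘ φ) (fun v => L v f) - f‖ := ((div_lt_iff₀' hc0).1 hfa).le
    _ ≤ ‖φ (fun v => L v f) - T f‖ := hR _ f
    _ = ‖A f - T f‖ := by rw [hAφ]

end Continuous

end LowerBounds

section Spectral

open Filter Topology

/-- The algorithm `f ↦ ∑ ⟨f, e_v⟩ T e_v`, `v < n`, which applies `T` to the orthogonal projection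
of `f` onto the span of the first `n` members of an orthonormal sequence `e`. -/
def spectralAlgorithm {E Y : Type*} [NormedAddCommGroup E] [InnerProductSpace ℝ E]
    [NormedAddCommGroup Y] [NormedSpace ℝ Y] (T : E →L[ℝ] Y) (e : ℕ → E) (n : ℕ) : E → Y := fun f =>
  ∑ v ∈ Finset.range n, inner ℝ f (e v) • T (e v)

theorem spectralAlgorithm_mem_linAlgorithms {E Y : Type*} [NormedAddCommGroup E]
    [InnerProductSpace ℝ E] [NormedAddCommGroup Y] [NormedSpace ℝ Y] (T : E →L[ℝ] Y) (e : ℕ → E)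
    (n : ℕ) : spectralAlgorithm T e n ∈ linAlgorithms E Y n := by
  refine ⟨fun v => innerSL ℝ (e v), fun v => T (e v), fun f => ?_⟩
  rw [spectralAlgorithm, Finset.sum_range]
  simp only [innerSL_apply_apply, real_inner_comm]

theorem inner_sub_sum_inner_smul {E : Type*} [NormedAddCommGroup E] [InnerProductSpace ℝ E]
    {ι : Type*} [DecidableEq ι] {e : ι → E} (he : Orthonormal ℝ e) (s : Finset ι) (x : E) (i : ι) :
    inner ℝ (e i) (x - ∑ j ∈ s, inner ℝ x (e j) • e j) = if i ∈ s then 0 else inner ℝ (e i) x := by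
  simp only [inner_sub_right, inner_sum, real_inner_smul_right, orthonormal_iff_ite.1 he,
    mul_ite, mul_one, mul_zero, Finset.sum_ite_eq]
  split_ifs
  · rw [real_inner_comm, sub_self]
  · rw [sub_zero]

theorem summable_inner_smul {E : Type*} [NormedAddCommGroup E] [InnerProductSpace ℝ E]
    [CompleteSpace E] {ι : Type*} {e : ι → E} (he : Orthonormal ℝ e) (x : E) :
    Summable fun i => inner ℝ (e i) x • e i := by
  have h := (he.orthogonalFamily.summable_iff_norm_sq_summable fun i => inner ℝ (e i) x).2
    (he.inner_products_summable x)
  simpa using h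

namespace IsEigenpairSequence

variable {E Y : Type*} [NormedAddCommGroup E] [InnerProductSpace ℝ E] [CompleteSpace E]
  [NormedAddCommGroup Y] [InnerProductSpace ℝ Y] [CompleteSpace Y] {T : E →L[ℝ] Y} {e : ℕ → E}
  {lam : ℕ → ℝ}

theorem inner_apply (he : IsEigenpairSequence (T.adjoint.comp T) e lam) (i : ℕ) (x : E) :
    inner ℝ (T (e i)) (T x) = lam i * inner ℝ (e i) x := by
  rw [← ContinuousLinearMap.adjoint_inner_left, ← ContinuousLinearMap.comp_apply, he.eigen,
    real_inner_smul_left]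

theorem norm_apply_sq (he : IsEigenpairSequence (T.adjoint.comp T) e lam) (i : ℕ) :
    ‖T (e i)‖ ^ 2 = lam i := by
  rw [← real_inner_self_eq_norm_sq, he.inner_apply, real_inner_self_eq_norm_sq,
    he.orthonormal.1, one_pow, mul_one]

theorem norm_apply (he : IsEigenpairSequence (T.adjoint.comp T) e lam) (i : ℕ) :
    ‖T (e i)‖ = √(lam i) := by
  rw [← he.norm_apply_sq, Real.sqrt_sq (norm_nonneg _)]

theorem apply_eq_zero (he : IsEigenpairSequence (T.adjoint.comp T) e lam) {x : E}
    (hx : ∀ i, inner ℝ (e i) x = 0) : T x = 0 := by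
  rw [← inner_self_eq_zero (𝕜 := ℝ), ← ContinuousLinearMap.adjoint_inner_left,
    ← ContinuousLinearMap.comp_apply, he.exhausts x hx, inner_zero_left]

theorem hasSum_inner_smul_apply (he : IsEigenpairSequence (T.adjoint.comp T) e lam) (x : E) :
    HasSum (fun i => inner ℝ (e i) x • T (e i)) (T x) := by
  have hsum := (summable_inner_smul he.orthonormal x).hasSum
  set z := ∑' j, inner ℝ (e j) x • e j
  have hz (i : ℕ) : inner ℝ (e i) z = inner ℝ (e i) x := by
    have hcoeff : HasSum (fun j => inner ℝ (e i) (inner ℝ (e j) x • e j)) (inner ℝ (e i) z) :=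
      hsum.mapL (innerSL ℝ (e i))
    rw [hcoeff.unique (hasSum_single i fun j hj => ?_), real_inner_smul_right,
      real_inner_self_eq_norm_sq, he.orthonormal.1, one_pow, mul_one]
    rw [real_inner_smul_right, he.orthonormal.2 hj.symm, mul_zero]
  have hTz : T x = T z := by
    rw [← sub_eq_zero, ← map_sub]
    exact he.apply_eq_zero fun i => by rw [inner_sub_right, hz, sub_self]
  rw [hTz]
  simpa only [map_smul] using hsum.mapL T

theorem hasSum_norm_apply_sq (he : IsEigenpairSequence (T.adjoint.comp T) e lam) (x : E) :
    HasSum (fun i => lam i * inner ℝ (e i) x ^ 2) (‖T x‖ ^ 2) := by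
  have h := (he.hasSum_inner_smul_apply x).mapL (innerSL ℝ (T x))
  simpa only [innerSL_apply_apply, real_inner_smul_right, real_inner_comm (T (e _)) (T x),
    he.inner_apply, real_inner_self_eq_norm_sq, mul_left_comm, ← sq] using h

theorem adjoint_apply_mem_topologicalClosure_span
    (he : IsEigenpairSequence (T.adjoint.comp T) e lam) (x : E) :
    T.adjoint (T x) ∈ (Submodule.span ℝ (Set.range e)).topologicalClosure := by
  have hsum := (he.hasSum_inner_smul_apply x).mapL T.adjoint
  refine mem_closure_of_tendsto hsum (.of_forall fun s => Submodule.sum_mem _ fun i _ => ?_)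
  rw [map_smul, ← ContinuousLinearMap.comp_apply, he.eigen]
  exact Submodule.smul_mem _ _ (Submodule.smul_mem _ _ (Submodule.subset_span ⟨i, rfl⟩))

theorem norm_spectralAlgorithm_sub_le (he : IsEigenpairSequence (T.adjoint.comp T) e lam) (n : ℕ)
    (f : E) : ‖spectralAlgorithm T e n f - T f‖ ≤ √(lam n) * ‖f‖ := by
  let y := f - ∑ j ∈ Finset.range n, inner ℝ f (e j) • e j
  have hTy : spectralAlgorithm T e n f - T f = -T y := by
    simp only [y, spectralAlgorithm, map_sub, map_sum, map_smul, neg_sub]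
  have hterm (i : ℕ) : lam i * inner ℝ (e i) y ^ 2 ≤ lam n * inner ℝ (e i) f ^ 2 := by
    rw [inner_sub_sum_inner_smul he.orthonormal]
    split_ifs with hi
    · rw [zero_pow two_ne_zero, mul_zero]
      exact mul_nonneg (he.nonneg n) (sq_nonneg _)
    · gcongr
      exact he.antitone (by simpa using hi)
  have hbessel : Summable fun i => inner ℝ (e i) f ^ 2 := by
    simpa only [Real.norm_eq_abs, sq_abs] using he.orthonormal.inner_products_summable f
  refine le_of_sq_le_sq ?_ (by positivity)
  calc ‖spectralAlgorithm T e n f - T f‖ ^ 2 = ‖T y‖ ^ 2 := by rw [hTy, norm_neg]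
    _ ≤ lam n * ∑' i, inner ℝ (e i) f ^ 2 :=
      hasSum_le hterm (he.hasSum_norm_apply_sq y) (hbessel.hasSum.mul_left _)
    _ ≤ lam n * ‖f‖ ^ 2 := by
      refine mul_le_mul_of_nonneg_left ?_ (he.nonneg n)
      simpa only [Real.norm_eq_abs, sq_abs] using he.orthonormal.tsum_inner_products_le f
    _ = (√(lam n) * ‖f‖) ^ 2 := by rw [mul_pow, Real.sq_sqrt (he.nonneg n)]

theorem worstCaseError_spectralAlgorithm (he : IsEigenpairSequence (T.adjoint.comp T) e lam)
    (n : ℕ) : worstCaseError T (spectralAlgorithm T e n) = ENNReal.ofReal √(lam n) := by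
  refine le_antisymm (iSup₂_le fun f hf => ENNReal.ofReal_le_ofReal ?_) ?_
  · exact (he.norm_spectralAlgorithm_sub_le n f).trans
      (mul_le_of_le_one_right (Real.sqrt_nonneg _) (mem_closedBall_zero_iff.1 hf))
  · have hzero : spectralAlgorithm T e n (e n) = 0 := Finset.sum_eq_zero fun v hv => by
      rw [he.orthonormal.2 (Finset.mem_range.1 hv).ne', zero_smul]
    have h := ofReal_norm_sub_le_worstCaseError (S := T) (A := spectralAlgorithm T e n) (f := e n)
      (mem_closedBall_zero_iff.2 (he.orthonormal.1 n).le)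
    rwa [hzero, zero_sub, norm_neg, he.norm_apply] at h

theorem sqrt_mul_norm_le_norm_apply (he : IsEigenpairSequence (T.adjoint.comp T) e lam) {n : ℕ}
    {f : E} (hf : f ∈ Submodule.span ℝ (Set.range fun i : Fin (n + 1) => e i)) :
    √(lam n) * ‖f‖ ≤ ‖T f‖ := by
  obtain ⟨c, rfl⟩ := (Submodule.mem_span_range_iff_exists_fun ℝ).1 hf
  have hon : Orthonormal ℝ fun i : Fin (n + 1) => e i :=
    he.orthonormal.comp _ Fin.val_injective
  refine le_of_sq_le_sq ?_ (norm_nonneg _)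
  calc (√(lam n) * ‖∑ i, c i • e i‖) ^ 2 = ∑ i, lam n * c i ^ 2 := by
        rw [mul_pow, Real.sq_sqrt (he.nonneg n), ← real_inner_self_eq_norm_sq, hon.inner_sum,
          Finset.mul_sum]
        simp only [conj_trivial, ← sq]
    _ ≤ ∑ i : Fin (n + 1), lam i * c i ^ 2 := Finset.sum_le_sum fun i _ => by
        gcongr
        exact he.antitone i.is_le
    _ = ‖T (∑ i, c i • e i)‖ ^ 2 := by
        have happly : T.adjoint (T (∑ i : Fin (n + 1), c i • e i)) =
            ∑ i : Fin (n + 1), (lam i * c i) • e i := by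
          rw [← ContinuousLinearMap.comp_apply, map_sum]
          simp only [map_smul, he.eigen, smul_smul, mul_comm]
        rw [← real_inner_self_eq_norm_sq, ← ContinuousLinearMap.adjoint_inner_left, happly,
          hon.inner_sum]
        simp only [conj_trivial, mul_assoc, ← sq]

theorem minimalError_eq (he : IsEigenpairSequence (T.adjoint.comp T) e lam) {n : ℕ}
    {𝒜 : Set (E → Y)} (hlin : linAlgorithms E Y n ⊆ 𝒜)
    (h𝒜 : 𝒜 ⊆ contAlgorithms E Y n ∪ adaptAlgorithms E Y n) :
    minimalError T 𝒜 = ENNReal.ofReal √(lam n) := by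
  refine le_antisymm ?_ (le_iInf₂ fun A hA => ?_)
  · rw [← he.worstCaseError_spectralAlgorithm n]
    exact iInf₂_le _ (hlin (spectralAlgorithm_mem_linAlgorithms T e n))
  · let V := Submodule.span ℝ (Set.range fun i : Fin (n + 1) => e i)
    have hV : n < Module.finrank ℝ V := by
      have hli : LinearIndependent ℝ fun i : Fin (n + 1) => e i :=
        (he.orthonormal.comp _ Fin.val_injective).linearIndependent
      rw [finrank_span_eq_card hli, Fintype.card_fin]
      exact n.lt_succ_self
    have hVT (f : E) (hf : f ∈ V) : √(lam n) * ‖f‖ ≤ ‖T.toLinearMap f‖ :=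
      he.sqrt_mul_norm_le_norm_apply hf
    exact (h𝒜 hA).elim (ofReal_le_worstCaseError_of_mem_contAlgorithms hV hVT)
      (ofReal_le_worstCaseError_of_mem_adaptAlgorithms hV hVT)

theorem tendsto_zero (he : IsEigenpairSequence (T.adjoint.comp T) e lam)
    (hT : IsCompactOperator T) : Tendsto lam atTop (𝓝 0) := by
  have hK : IsCompact (closure (T '' Metric.closedBall 0 1)) :=
    IsCompactOperator.isCompact_closure_image_closedBall (f := (T : E →ₗ[ℝ] Y)) hT 1
  obtain ⟨y, -, φ, hφ, hlim⟩ := hK.tendsto_subseq (x := fun i => T (e i)) fun i =>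
    subset_closure ⟨e i, by simp [he.orthonormal.1 i], rfl⟩
  have hdist (k : ℕ) : ‖T (e (φ k)) - T (e (φ (k + 1)))‖ ^ 2 = lam (φ k) + lam (φ (k + 1)) := by
    rw [norm_sub_sq_real, he.inner_apply, he.orthonormal.2 (hφ k.lt_succ_self).ne,
      he.norm_apply_sq, he.norm_apply_sq, mul_zero, mul_zero, sub_zero]
  have hdiff : Tendsto (fun k => ‖T (e (φ k)) - T (e (φ (k + 1)))‖ ^ 2) atTop (𝓝 0) := by
    simpa using ((hlim.sub (hlim.comp (tendsto_add_atTop_nat 1))).norm).pow 2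
  rw [tendsto_iff_tendsto_subseq_of_antitone he.antitone hφ.tendsto_atTop]
  exact squeeze_zero (fun k => he.nonneg _)
    (fun k => by rw [hdist]; exact le_add_of_nonneg_right (he.nonneg _)) hdiff

end IsEigenpairSequence

end Spectral

section Permutations

theorem exists_perm_monotone_comp {ι α : Type*} [Finite ι] [LinearOrder ι] [LinearOrder α]
    (k : ι → α) : ∃ τ : Equiv.Perm ι, Monotone (k ∘ τ) := by
  have := Fintype.ofFinite ι
  let o := Fintype.orderIsoFinOfCardEq ι rfl
  refine ⟨(o.symm.toEquiv.trans (Tuple.sort (k ∘ o))).trans o.toEquiv, ?_⟩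
  exact (Tuple.monotone_sort (k ∘ o)).comp o.symm.monotone

theorem comp_perm_eq_of_monotone {ι α : Type*} [Finite ι] [LinearOrder ι] [LinearOrder α]
    {k : ι → α} {τ : Equiv.Perm ι} (hk : Monotone k) (hkτ : Monotone (k ∘ τ)) : k ∘ τ = k := by
  have := Fintype.ofFinite ι
  let o := Fintype.orderIsoFinOfCardEq ι rfl
  have hcomp : (k ∘ o) ∘ ((o.toEquiv.trans τ).trans o.symm.toEquiv) = (k ∘ τ) ∘ o := by
    ext j
    simp
  have hmono : (k ∘ o) ∘ ((o.toEquiv.trans τ).trans o.symm.toEquiv) = (k ∘ o) ∘ Equiv.refl _ :=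
    Tuple.unique_monotone (hcomp ▸ hkτ.comp o.monotone) (hk.comp o.monotone)
  exact o.surjective.injective_comp_right (hcomp.symm.trans hmono)

variable {d : ℕ} {I : Finset (Fin d)} {s : SymmetryType} {π : Equiv.Perm (Fin d)}

theorem mem_permsOn : π ∈ permsOn I ↔ ∀ i, i ∉ I → π i = i := by
  simp only [permsOn, Finset.mem_filter, Finset.mem_univ, true_and]

theorem inv_mem_permsOn (hπ : π ∈ permsOn I) : π⁻¹ ∈ permsOn I :=
  mem_permsOn.2 fun i hi => by rw [Equiv.Perm.inv_eq_iff_eq, mem_permsOn.1 hπ i hi]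

theorem mul_mem_permsOn {σ : Equiv.Perm (Fin d)} (hπ : π ∈ permsOn I) (hσ : σ ∈ permsOn I) :
    π * σ ∈ permsOn I :=
  mem_permsOn.2 fun i hi => by
    rw [Equiv.Perm.mul_apply, mem_permsOn.1 hσ i hi, mem_permsOn.1 hπ i hi]

theorem swap_mem_permsOn {a b : Fin d} (ha : a ∈ I) (hb : b ∈ I) : Equiv.swap a b ∈ permsOn I :=
  mem_permsOn.2 fun _ hi =>
    Equiv.swap_apply_of_ne_of_ne (ne_of_mem_of_not_mem ha hi).symm (ne_of_mem_of_not_mem hb hi).symm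

theorem mem_permsOn_iff_exists_ofSubtype :
    π ∈ permsOn I ↔ ∃ τ : Equiv.Perm I, Equiv.Perm.ofSubtype τ = π := by
  rw [mem_permsOn]
  refine ⟨fun hπ => ?_, ?_⟩
  · obtain ⟨τ, hτ⟩ := (Equiv.Perm.subtypeEquivSubtypePerm (· ∈ I)).surjective ⟨π, hπ⟩
    exact ⟨τ, congrArg Subtype.val hτ⟩
  · rintro ⟨τ, rfl⟩ i hi
    exact Equiv.Perm.ofSubtype_apply_of_not_mem τ hi

theorem card_permsOn_pos (I : Finset (Fin d)) : 0 < (permsOn I).card :=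
  Finset.card_pos.2 ⟨1, mem_permsOn.2 fun _ _ => rfl⟩

theorem comp_ofSubtype_comp_val {α : Type*} (k : Fin d → α) (τ : Equiv.Perm I) :
    (k ∘ Equiv.Perm.ofSubtype τ) ∘ Subtype.val = (k ∘ Subtype.val) ∘ τ := by
  ext i
  simp only [Function.comp_apply, Equiv.Perm.ofSubtype_apply_coe]

theorem comp_ofSubtype_eq_iff {α : Type*} (k : Fin d → α) (τ : Equiv.Perm I) :
    k ∘ Equiv.Perm.ofSubtype τ = k ↔ (k ∘ Subtype.val) ∘ τ = k ∘ Subtype.val := by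
  rw [← comp_ofSubtype_comp_val]
  refine ⟨congrArg (· ∘ Subtype.val), fun h => funext fun i => ?_⟩
  by_cases hi : i ∈ I
  · exact congrFun h ⟨i, hi⟩
  · rw [Function.comp_apply, Equiv.Perm.ofSubtype_apply_of_not_mem τ hi]

theorem monotone_comp_val_iff {α : Type*} [Preorder α] {k : Fin d → α} :
    Monotone (k ∘ (Subtype.val : I → Fin d)) ↔ MonotoneOn k (I : Set (Fin d)) :=
  ⟨fun h a ha b hb hab => h (a := ⟨a, ha⟩) (b := ⟨b, hb⟩) hab, fun h a b hab => h a.2 b.2 hab⟩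

theorem exists_mem_permsOn_monotoneOn {α : Type*} [LinearOrder α] (I : Finset (Fin d))
    (k : Fin d → α) :
    ∃ π ∈ permsOn I, MonotoneOn (k ∘ π) (I : Set (Fin d)) := by
  obtain ⟨τ, hτ⟩ := exists_perm_monotone_comp (k ∘ (Subtype.val : I → Fin d))
  refine ⟨Equiv.Perm.ofSubtype τ, mem_permsOn_iff_exists_ofSubtype.2 ⟨τ, rfl⟩, ?_⟩
  rwa [← monotone_comp_val_iff, comp_ofSubtype_comp_val]

theorem comp_eq_of_monotoneOn {α : Type*} [LinearOrder α] (hπ : π ∈ permsOn I) {k : Fin d → α}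
    (hk : MonotoneOn k (I : Set (Fin d))) (hkπ : MonotoneOn (k ∘ π) (I : Set (Fin d))) :
    k ∘ π = k := by
  obtain ⟨τ, rfl⟩ := mem_permsOn_iff_exists_ofSubtype.1 hπ
  rw [← monotone_comp_val_iff] at hk hkπ
  rw [comp_ofSubtype_comp_val] at hkπ
  exact (comp_ofSubtype_eq_iff k τ).2 (comp_perm_eq_of_monotone hk hkπ)

theorem card_filter_comp_eq_multFactorial (I : Finset (Fin d)) (k : Fin d → ℕ) :
    ((permsOn I).filter fun π : Equiv.Perm (Fin d) => k ∘ π = k).card = multFactorial I k := by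
  let k' : I → ℕ := k ∘ Subtype.val
  have hfiber (m : ℕ) : Fintype.card {i // k' i = m} = (I.filter fun i => k i = m).card := by
    rw [← Fintype.card_coe]
    exact Fintype.card_congr ((Equiv.subtypeSubtypeEquivSubtypeInter (· ∈ I) (k · = m)).trans
      (Equiv.subtypeEquivRight fun _ => by rw [Finset.mem_filter]))
  have himage : Finset.univ.image k' = I.image k := by
    ext m
    simp [k']
  calc ((permsOn I).filter fun π : Equiv.Perm (Fin d) => k ∘ π = k).card
      = (Finset.univ.filter fun τ : Equiv.Perm I => k' ∘ τ = k').card := by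
        rw [← Finset.card_map ⟨_, Equiv.Perm.ofSubtype_injective⟩]
        congr 1
        ext π
        simp only [Finset.mem_filter, Finset.mem_map, Finset.mem_univ, true_and,
          Function.Embedding.coeFn_mk, mem_permsOn_iff_exists_ofSubtype]
        constructor
        · rintro ⟨⟨τ, rfl⟩, hτ⟩
          exact ⟨τ, (comp_ofSubtype_eq_iff k τ).1 hτ, rfl⟩
        · rintro ⟨τ, hτ, rfl⟩
          exact ⟨⟨τ, rfl⟩, (comp_ofSubtype_eq_iff k τ).2 hτ⟩
    _ = multFactorial I k := by
        rw [← Fintype.card_subtype, DomMulAct.stabilizer_card', himage, multFactorial]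
        simp only [hfiber]

theorem multFactorial_pos (I : Finset (Fin d)) (k : Fin d → ℕ) : 0 < multFactorial I k :=
  Finset.prod_pos fun _ _ => Nat.factorial_pos _

theorem SymmetryType.factor_one (s : SymmetryType) : s.factor (1 : Equiv.Perm (Fin d)) = 1 := by
  cases s <;> simp [SymmetryType.factor]

theorem SymmetryType.factor_inv (s : SymmetryType) (π : Equiv.Perm (Fin d)) :
    s.factor π⁻¹ = s.factor π := by
  cases s <;> simp [SymmetryType.factor]

theorem SymmetryType.factor_mul_self (s : SymmetryType) (π : Equiv.Perm (Fin d)) :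
    s.factor π * s.factor π = 1 := by
  calc s.factor π * s.factor π = s.factor π⁻¹ * s.factor π := by rw [s.factor_inv]
    _ = 1 := by rw [← SymmetryType.factor_mul, inv_mul_cancel, s.factor_one]

theorem SymmetryType.factor_antisymmetric_swap {a b : Fin d} (hab : a ≠ b) :
    SymmetryType.antisymmetric.factor (Equiv.swap a b) = -1 := by
  simp [SymmetryType.factor, Equiv.Perm.sign_swap hab]

theorem eq_one_of_injOn_of_comp_eq {α : Type*} (hπ : π ∈ permsOn I) {k : Fin d → α}
    (hk : Set.InjOn k (I : Set (Fin d))) (hkπ : k ∘ π = k) : π = 1 := by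
  obtain ⟨τ, rfl⟩ := mem_permsOn_iff_exists_ofSubtype.1 hπ
  have hτ : τ = 1 := Equiv.ext fun i =>
    hk.injective (congrFun ((comp_ofSubtype_eq_iff k τ).1 hkπ) i)
  rw [hτ, map_one]

/- In the antisymmetric case the second condition excludes repeated entries, because the
transposition of two equal entries has factor `-1`. -/
theorem mem_nabla_iff {k : Fin d → ℕ} : k ∈ nabla s I ↔
    MonotoneOn k (I : Set (Fin d)) ∧ ∀ π ∈ permsOn I, k ∘ π = k → s.factor π = 1 := by
  cases s with
  | symmetric => exact ⟨fun hk => ⟨hk, fun _ _ _ => rfl⟩, And.left⟩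
  | antisymmetric =>
    refine ⟨fun hk => ⟨StrictMonoOn.monotoneOn hk, fun π hπ hkπ => ?_⟩, fun ⟨hmono, hfactor⟩ => ?_⟩
    · rw [eq_one_of_injOn_of_comp_eq hπ (StrictMonoOn.injOn hk) hkπ, SymmetryType.factor_one]
    · refine hmono.strictMonoOn_of_injOn fun a ha b hb hab => by_contra fun hne => ?_
      have hswap : k ∘ Equiv.swap a b = k := by
        rw [Equiv.comp_swap_eq_update, hab, Function.update_eq_self, ← hab, Function.update_eq_self]
      have hone := hfactor _ (swap_mem_permsOn ha hb) hswap
      norm_num [SymmetryType.factor_antisymmetric_swap hne] at hone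

end Permutations

section MultilinearClosure

theorem multilinearMap_eq_zero_of_mem_topologicalClosure_span {R ι : Type*} {M : ι → Type*}
    {N : Type*} [Finite ι] [CommRing R] [∀ i, AddCommGroup (M i)]
    [∀ i, Module R (M i)] [∀ i, TopologicalSpace (M i)] [∀ i, ContinuousAdd (M i)]
    [∀ i, ContinuousConstSMul R (M i)] [AddCommGroup N] [Module R N] [TopologicalSpace N]
    [T1Space N] (L : ContinuousMultilinearMap R M N) {t : ∀ i, Set (M i)}
    (hL : ∀ f, (∀ i, f i ∈ t i) → L f = 0) {f : ∀ i, M i}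
    (hf : ∀ i, f i ∈ (Submodule.span R (t i)).topologicalClosure) : L f = 0 := by
  classical
  have := Fintype.ofFinite ι
  suffices key : ∀ (J : Finset ι) (f : ∀ i, M i),
      (∀ i ∈ J, f i ∈ (Submodule.span R (t i)).topologicalClosure) → (∀ i ∉ J, f i ∈ t i) →
      L f = 0 from
    key Finset.univ f (fun i _ => hf i) fun i hi => absurd (Finset.mem_univ i) hi
  intro J
  induction J using Finset.induction_on with
  | empty => exact fun f _ hf => hL f fun i => hf i (Finset.notMem_empty i)
  | insert a J ha ih =>
    intro f hf hf'
    have hker : (Submodule.span R (t a)).topologicalClosure ≤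
        (L.toContinuousLinearMap f a).ker := by
      refine Submodule.topologicalClosure_minimal _ (Submodule.span_le.2 fun x hx => ?_)
        (L.toContinuousLinearMap f a).isClosed_ker
      change L (Function.update f a x) = 0
      refine ih _ (fun i hi => ?_) fun i hi => ?_
      · rw [Function.update_of_ne (ne_of_mem_of_not_mem hi ha)]
        exact hf i (Finset.mem_insert_of_mem hi)
      · rcases eq_or_ne i a with rfl | hia
        · rwa [Function.update_self]
        · rw [Function.update_of_ne hia]
          exact hf' i fun h => (Finset.mem_insert.1 h).elim hia hi
    have hfa : L (Function.update f a (f a)) = 0 := hker (hf a (Finset.mem_insert_self a J))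
    rwa [Function.update_eq_self] at hfa

end MultilinearClosure

section TensorOperators

variable {d : ℕ} {H G K : Type*} [NormedAddCommGroup H] [InnerProductSpace ℝ H]
  [NormedAddCommGroup G] [InnerProductSpace ℝ G] [NormedAddCommGroup K] [InnerProductSpace ℝ K]

theorem norm_pureTensor (f : Fin d → H) : ‖pureTensor f‖ = ∏ l, ‖f l‖ := by
  rw [← sq_eq_sq₀ (norm_nonneg _) (Finset.prod_nonneg fun _ _ => norm_nonneg _),
    ← real_inner_self_eq_norm_sq, inner_pureTensor, ← Finset.prod_pow]
  simp only [real_inner_self_eq_norm_sq]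

/-- The map `f ↦ f 0 ⊗ ⋯ ⊗ f (d - 1)` as a continuous multilinear map. -/
noncomputable def pureTensorMultilinear (d : ℕ) (H : Type*) [NormedAddCommGroup H]
    [InnerProductSpace ℝ H] :
    ContinuousMultilinearMap ℝ (fun _ : Fin d => H) (HilbertTensorPower d H) :=
  MultilinearMap.mkContinuous
    ((UniformSpace.Completion.toComplL (𝕜 := ℝ) (E := AlgTensorPower d H)).toLinearMap
      |>.compMultilinearMap (AlgTensorPower.tprod d H)) 1
    fun f => (norm_pureTensor f).trans_le (one_mul _).ge

theorem pureTensor_smul (c : Fin d → ℝ) (f : Fin d → H) :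
    pureTensor (fun l => c l • f l) = (∏ l, c l) • pureTensor f :=
  (pureTensorMultilinear d H).map_smul_univ c f

theorem eq_zero_of_forall_inner_pureTensor_eq_zero {x : HilbertTensorPower d H}
    (hx : ∀ f, inner ℝ x (pureTensor f) = 0) : x = 0 :=
  inner_self_eq_zero.1 (DFunLike.congr_fun (tensor_hom_ext (φ := innerSL ℝ x) (ψ := 0) hx) x)

theorem inner_apply_eq_of_pureTensor {A : HilbertTensorPower d H →L[ℝ] HilbertTensorPower d G}
    {B : HilbertTensorPower d G →L[ℝ] HilbertTensorPower d H}
    (h : ∀ f g, inner ℝ (A (pureTensor f)) (pureTensor g) =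
      inner ℝ (pureTensor f) (B (pureTensor g)))
    (x : HilbertTensorPower d H) (y : HilbertTensorPower d G) :
    inner ℝ (A x) y = inner ℝ x (B y) := by
  have hright (f : Fin d → H) : innerSL ℝ (A (pureTensor f)) = (innerSL ℝ (pureTensor f)).comp B :=
    tensor_hom_ext fun g => h f g
  have hleft : (innerSL ℝ y).comp A = innerSL ℝ (B y) := tensor_hom_ext fun f => by
    simpa only [innerSL_apply_apply, ContinuousLinearMap.comp_apply, real_inner_comm] using
      DFunLike.congr_fun (hright f) y
  simpa only [innerSL_apply_apply, ContinuousLinearMap.comp_apply, real_inner_comm] using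
    DFunLike.congr_fun hleft x

theorem adjoint_tensorOp [CompleteSpace H] [CompleteSpace G] (S : H →L[ℝ] G) :
    (tensorOp d S).adjoint = tensorOp d S.adjoint := by
  refine ((ContinuousLinearMap.eq_adjoint_iff _ _).2
    (inner_apply_eq_of_pureTensor fun f g => ?_)).symm
  simp only [tensorOp_pureTensor, inner_pureTensor, ContinuousLinearMap.adjoint_inner_left]

theorem tensorOp_comp (R : G →L[ℝ] K) (S : H →L[ℝ] G) :
    (tensorOp d R).comp (tensorOp d S) = tensorOp d (R.comp S) :=
  tensor_hom_ext fun f => by simp only [ContinuousLinearMap.comp_apply, tensorOp_pureTensor]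

theorem adjoint_tensorOp_comp_tensorOp [CompleteSpace H] [CompleteSpace G] (S : H →L[ℝ] G) :
    (tensorOp d S).adjoint.comp (tensorOp d S) = tensorOp d (S.adjoint.comp S) := by
  rw [adjoint_tensorOp, tensorOp_comp]

theorem tensorOp_comp_permOp (S : H →L[ℝ] G) (π : Equiv.Perm (Fin d)) :
    (tensorOp d S).comp (permOp H π) = (permOp G π).comp (tensorOp d S) :=
  tensor_hom_ext fun f => by
    simp only [ContinuousLinearMap.comp_apply, permOp_pureTensor, tensorOp_pureTensor]

theorem inner_permOp_left (π : Equiv.Perm (Fin d)) (x y : HilbertTensorPower d H) :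
    inner ℝ (permOp H π x) y = inner ℝ x (permOp H π⁻¹ y) := by
  refine inner_apply_eq_of_pureTensor (fun f g => ?_) x y
  simp only [permOp_pureTensor, inner_pureTensor]
  rw [← Equiv.prod_comp π fun l => inner ℝ (f l) (g (π⁻¹ l))]
  simp only [Equiv.Perm.inv_def, Equiv.symm_apply_apply]

end TensorOperators

section Symmetrization

variable {d : ℕ} {H G : Type*} [NormedAddCommGroup H] [InnerProductSpace ℝ H]
  [NormedAddCommGroup G] [InnerProductSpace ℝ G] {s : SymmetryType} {I : Finset (Fin d)}

theorem symmetrizer_apply (s : SymmetryType) (I : Finset (Fin d)) (x : HilbertTensorPower d H) :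
    symmetrizer s I H x =
      ((permsOn I).card : ℝ)⁻¹ • ∑ π ∈ permsOn I, s.factor π • permOp H π x := by
  simp only [symmetrizer, smul_apply, sum_apply]

theorem inner_symmetrizer_left (s : SymmetryType) (I : Finset (Fin d))
    (x y : HilbertTensorPower d H) :
    inner ℝ (symmetrizer s I H x) y = inner ℝ x (symmetrizer s I H y) := by
  simp only [symmetrizer_apply, real_inner_smul_left, real_inner_smul_right, sum_inner, inner_sum]
  congr 1
  refine Finset.sum_bij' (fun π _ => π⁻¹) (fun π _ => π⁻¹) (fun π hπ => inv_mem_permsOn hπ)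
    (fun π hπ => inv_mem_permsOn hπ) (fun π _ => inv_inv π) (fun π _ => inv_inv π) fun π _ => ?_
  rw [inner_permOp_left, s.factor_inv]

theorem tensorOp_symmetrizer (s : SymmetryType) (I : Finset (Fin d)) (S : H →L[ℝ] G)
    (x : HilbertTensorPower d H) :
    tensorOp d S (symmetrizer s I H x) = symmetrizer s I G (tensorOp d S x) := by
  have hperm (π : Equiv.Perm (Fin d)) :
      tensorOp d S (permOp H π x) = permOp G π (tensorOp d S x) :=
    DFunLike.congr_fun (tensorOp_comp_permOp S π) x
  simp only [symmetrizer_apply, map_smul, map_sum, hperm]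

theorem symmetrizer_permOp {π : Equiv.Perm (Fin d)} (hπ : π ∈ permsOn I)
    (x : HilbertTensorPower d H) :
    symmetrizer s I H (permOp H π x) = s.factor π • symmetrizer s I H x := by
  rw [symmetrizer_apply, symmetrizer_apply, smul_comm, Finset.smul_sum (r := s.factor π)]
  congr 1
  refine Finset.sum_bij' (fun σ _ => π * σ) (fun σ _ => π⁻¹ * σ)
    (fun σ hσ => mul_mem_permsOn hπ hσ) (fun σ hσ => mul_mem_permsOn (inv_mem_permsOn hπ) hσ)
    (fun σ _ => inv_mul_cancel_left π σ) (fun σ _ => mul_inv_cancel_left π σ) fun σ _ => ?_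
  rw [← ContinuousLinearMap.comp_apply, permOp_comp, SymmetryType.factor_mul, smul_smul,
    ← mul_assoc, s.factor_mul_self, one_mul]

theorem symmetrizer_mem_symSubspace (s : SymmetryType) (I : Finset (Fin d))
    (x : HilbertTensorPower d H) : symmetrizer s I H x ∈ symSubspace s I H :=
  LinearMap.mem_range_self _ x

theorem symmetrizer_eq_self {x : HilbertTensorPower d H} (hx : x ∈ symSubspace s I H) :
    symmetrizer s I H x = x := by
  obtain ⟨y, rfl⟩ := hx
  exact DFunLike.congr_fun (symmetrizer_comp_self s I H) y

theorem tensorOp_mem_symSubspace (S : H →L[ℝ] G) {x : HilbertTensorPower d H}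
    (hx : x ∈ symSubspace s I H) : tensorOp d S x ∈ symSubspace s I G := by
  rw [← symmetrizer_eq_self hx, tensorOp_symmetrizer]
  exact symmetrizer_mem_symSubspace s I _

theorem coe_adjoint_symProblem_apply [CompleteSpace H] [CompleteSpace G] (S : H →L[ℝ] G)
    (f : symSubspace s I H) :
    ((symProblem s I S).adjoint (symProblem s I S f) : HilbertTensorPower d H) =
      (tensorOp d S).adjoint (tensorOp d S f) := by
  have hmem : (tensorOp d S).adjoint (tensorOp d S f) ∈ symSubspace s I H := by
    rw [adjoint_tensorOp]
    exact tensorOp_mem_symSubspace _ (tensorOp_mem_symSubspace _ f.2)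
  rw [symProblem, ContinuousLinearMap.adjoint_comp, Submodule.adjoint_subtypeL]
  exact congrArg Subtype.val
    ((symSubspace s I H).orthogonalProjectionOnto_mem_subspace_eq_self ⟨_, hmem⟩)

theorem coe_adjoint_symProblem_apply_eq_tensorOp [CompleteSpace H] [CompleteSpace G]
    (S : H →L[ℝ] G) (f : symSubspace s I H) :
    ((symProblem s I S).adjoint (symProblem s I S f) : HilbertTensorPower d H) =
      tensorOp d (S.adjoint.comp S) f := by
  rw [coe_adjoint_symProblem_apply, ← adjoint_tensorOp_comp_tensorOp,
    ContinuousLinearMap.comp_apply]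

end Symmetrization

section Eigenvectors

variable {d : ℕ} {H G : Type*} [NormedAddCommGroup H] [InnerProductSpace ℝ H]
  [NormedAddCommGroup G] [InnerProductSpace ℝ G] {s : SymmetryType} {I : Finset (Fin d)}
  {e : ℕ → H}

theorem coe_xi (s : SymmetryType) (I : Finset (Fin d)) (e : ℕ → H) (k : Fin d → ℕ) :
    (xi s I e k : HilbertTensorPower d H) =
      √(((permsOn I).card : ℝ) / (multFactorial I k : ℝ)) •
        symmetrizer s I H (pureTensor fun l => e (k l)) := rfl

theorem card_permsOn_div_multFactorial_pos (I : Finset (Fin d)) (k : Fin d → ℕ) :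
    0 < ((permsOn I).card : ℝ) / (multFactorial I k : ℝ) :=
  div_pos (Nat.cast_pos.2 (card_permsOn_pos I)) (Nat.cast_pos.2 (multFactorial_pos I k))

theorem inner_pureTensor_of_orthonormal {ι : Type*} [DecidableEq ι] {e : ι → H}
    (he : Orthonormal ℝ e) (j k : Fin d → ι) :
    inner ℝ (pureTensor fun l => e (j l)) (pureTensor fun l => e (k l)) =
      if j = k then 1 else 0 := by
  simp only [inner_pureTensor, orthonormal_iff_ite.1 he, Finset.prod_ite_zero, Finset.mem_univ,
    Finset.prod_const_one, forall_const, funext_iff]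

theorem inner_symmetrizer_pureTensor (he : Orthonormal ℝ e) (j k : Fin d → ℕ) :
    inner ℝ (symmetrizer s I H (pureTensor fun l => e (j l)))
        (symmetrizer s I H (pureTensor fun l => e (k l))) =
      ((permsOn I).card : ℝ)⁻¹ *
        ∑ π ∈ (permsOn I).filter fun π : Equiv.Perm (Fin d) => j ∘ π = k, s.factor π := by
  rw [← inner_symmetrizer_left, symmetrizer_eq_self (symmetrizer_mem_symSubspace s I _),
    symmetrizer_apply, real_inner_smul_left, sum_inner, Finset.sum_filter]
  congr 1
  refine Finset.sum_congr rfl fun π _ => ?_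
  have hinner : inner ℝ (pureTensor fun l => e (j (π l))) (pureTensor fun l => e (k l)) =
      if j ∘ π = k then (1 : ℝ) else 0 := inner_pureTensor_of_orthonormal he (j ∘ π) k
  rw [permOp_pureTensor, real_inner_smul_left, hinner, mul_ite, mul_one, mul_zero]

theorem sum_factor_eq_multFactorial {k : Fin d → ℕ} (hk : k ∈ nabla s I) :
    ∑ π ∈ (permsOn I).filter fun π : Equiv.Perm (Fin d) => k ∘ π = k, s.factor π =
      multFactorial I k := by
  rw [← card_filter_comp_eq_multFactorial, Finset.card_eq_sum_ones, Nat.cast_sum, Nat.cast_one]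
  refine Finset.sum_congr rfl fun π hπ => ?_
  obtain ⟨hπI, hkπ⟩ := Finset.mem_filter.1 hπ
  exact (mem_nabla_iff.1 hk).2 π hπI hkπ

theorem filter_permsOn_eq_empty {j k : Fin d → ℕ} (hj : j ∈ nabla s I) (hk : k ∈ nabla s I)
    (hjk : j ≠ k) : (permsOn I).filter (fun π : Equiv.Perm (Fin d) => j ∘ π = k) = ∅ :=
  Finset.filter_eq_empty_iff.2 fun _ hπ h =>
    hjk <| (comp_eq_of_monotoneOn hπ (mem_nabla_iff.1 hj).1
      (h ▸ (mem_nabla_iff.1 hk).1)).symm.trans h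

theorem orthonormal_xi (he : Orthonormal ℝ e) :
    Orthonormal ℝ fun k : nabla s I => xi s I e k := by
  classical
  rw [orthonormal_iff_ite]
  rintro ⟨j, hj⟩ ⟨k, hk⟩
  rw [Submodule.coe_inner, coe_xi, coe_xi, real_inner_smul_left, real_inner_smul_right,
    inner_symmetrizer_pureTensor he]
  rcases eq_or_ne j k with rfl | hjk
  · rw [if_pos rfl, sum_factor_eq_multFactorial hj, ← mul_assoc,
      Real.mul_self_sqrt (card_permsOn_div_multFactorial_pos I j).le]
    have hcard : ((permsOn I).card : ℝ) ≠ 0 := Nat.cast_ne_zero.2 (card_permsOn_pos I).ne'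
    have hmult : (multFactorial I j : ℝ) ≠ 0 := Nat.cast_ne_zero.2 (multFactorial_pos I j).ne'
    field_simp
  · rw [if_neg fun h => hjk (congrArg Subtype.val h), filter_permsOn_eq_empty hj hk hjk]
    simp only [Finset.sum_empty, mul_zero]

theorem symmetrizer_pureTensor_comp {π : Equiv.Perm (Fin d)} (hπ : π ∈ permsOn I) (e : ℕ → H)
    (k : Fin d → ℕ) :
    symmetrizer s I H (pureTensor fun l => e ((k ∘ π) l)) =
      s.factor π • symmetrizer s I H (pureTensor fun l => e (k l)) := by
  rw [← symmetrizer_permOp hπ, permOp_pureTensor]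
  rfl

theorem symmetrizer_pureTensor_eq_zero {k : Fin d → ℕ} (hmono : MonotoneOn k (I : Set (Fin d)))
    (hk : k ∉ nabla s I) (e : ℕ → H) : symmetrizer s I H (pureTensor fun l => e (k l)) = 0 := by
  simp only [mem_nabla_iff, hmono, true_and, not_forall] at hk
  obtain ⟨π, hπ, hkπ, hfactor⟩ := hk
  have h := symmetrizer_pureTensor_comp (s := s) hπ e k
  rw [hkπ, ← one_smul ℝ (symmetrizer s I H _), smul_smul, mul_one, ← sub_eq_zero, ← sub_smul,
    smul_eq_zero, sub_eq_zero] at h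
  exact h.resolve_left (Ne.symm hfactor)

theorem inner_pureTensor_eq_zero_of_inner_xi_eq_zero {f : symSubspace s I H}
    (hf : ∀ k ∈ nabla s I, inner ℝ (xi s I e k) f = 0) (k : Fin d → ℕ) :
    inner ℝ (f : HilbertTensorPower d H) (pureTensor fun l => e (k l)) = 0 := by
  have hsymm (x : HilbertTensorPower d H) :
      inner ℝ (f : HilbertTensorPower d H) x =
        inner ℝ (f : HilbertTensorPower d H) (symmetrizer s I H x) := by
    rw [← inner_symmetrizer_left, symmetrizer_eq_self f.2]
  obtain ⟨π, hπ, hmono⟩ := exists_mem_permsOn_monotoneOn I k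
  have hsorted : inner ℝ (f : HilbertTensorPower d H)
      (symmetrizer s I H (pureTensor fun l => e ((k ∘ π) l))) = 0 := by
    by_cases hmem : k ∘ π ∈ nabla s I
    · have h := hf _ hmem
      rw [Submodule.coe_inner, coe_xi, real_inner_smul_left, real_inner_comm] at h
      exact (mul_eq_zero.1 h).resolve_left
        (Real.sqrt_pos.2 (card_permsOn_div_multFactorial_pos I _)).ne'
    · rw [symmetrizer_pureTensor_eq_zero hmono hmem, inner_zero_right]
  rw [symmetrizer_pureTensor_comp hπ, real_inner_smul_right] at hsorted
  rw [hsymm]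
  exact (mul_eq_zero.1 hsorted).resolve_left
    (left_ne_zero_of_mul (s.factor_mul_self π ▸ one_ne_zero))

theorem inner_pureTensor_eq_zero_of_mem_topologicalClosure_span {f : symSubspace s I H}
    (hf : ∀ k ∈ nabla s I, inner ℝ (xi s I e k) f = 0) {g : Fin d → H}
    (hg : ∀ l, g l ∈ (Submodule.span ℝ (Set.range e)).topologicalClosure) :
    inner ℝ (f : HilbertTensorPower d H) (pureTensor g) = 0 := by
  refine multilinearMap_eq_zero_of_mem_topologicalClosure_span
    ((innerSL ℝ (f : HilbertTensorPower d H)).compContinuousMultilinearMap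
      (pureTensorMultilinear d H)) (fun f' hf' => ?_) hg
  choose k hk using hf'
  obtain rfl : (fun l => e (k l)) = f' := funext hk
  exact inner_pureTensor_eq_zero_of_inner_xi_eq_zero hf k

theorem topologicalClosure_span_xi_eq_top
    (he : (Submodule.span ℝ (Set.range e)).topologicalClosure = ⊤) :
    (Submodule.span ℝ (Set.range fun k : nabla s I => xi s I e k)).topologicalClosure = ⊤ := by
  rw [Submodule.topologicalClosure_eq_top_iff, Submodule.eq_bot_iff]
  intro f hf
  refine Subtype.ext (eq_zero_of_forall_inner_pureTensor_eq_zero fun g =>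
    inner_pureTensor_eq_zero_of_mem_topologicalClosure_span (e := e) (fun k hk => ?_) fun l => ?_)
  · exact hf _ (Submodule.subset_span ⟨⟨k, hk⟩, rfl⟩)
  · exact he ▸ Submodule.mem_top

variable [CompleteSpace H] [CompleteSpace G] {S : H →L[ℝ] G} {lam : ℕ → ℝ}

theorem adjoint_symProblem_comp_symProblem_xi
    (he : ∀ i, S.adjoint.comp S (e i) = lam i • e i) (k : Fin d → ℕ) :
    (symProblem s I S).adjoint.comp (symProblem s I S) (xi s I e k) =
      lamProd lam k • xi s I e k := by
  refine Subtype.ext ?_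
  rw [ContinuousLinearMap.comp_apply, coe_adjoint_symProblem_apply_eq_tensorOp,
    Submodule.coe_smul, coe_xi, map_smul, tensorOp_symmetrizer, tensorOp_pureTensor, smul_comm]
  simp only [he, pureTensor_smul, map_smul, lamProd]

theorem adjoint_symProblem_comp_symProblem_eq_zero
    (he : IsEigenpairSequence (S.adjoint.comp S) e lam) {f : symSubspace s I H}
    (hf : ∀ k ∈ nabla s I, inner ℝ (xi s I e k) f = 0) :
    (symProblem s I S).adjoint.comp (symProblem s I S) f = 0 := by
  refine Subtype.ext (eq_zero_of_forall_inner_pureTensor_eq_zero fun g => ?_)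
  rw [ContinuousLinearMap.comp_apply, coe_adjoint_symProblem_apply,
    ContinuousLinearMap.adjoint_inner_left, ← ContinuousLinearMap.adjoint_inner_right,
    ← ContinuousLinearMap.comp_apply, adjoint_tensorOp_comp_tensorOp, tensorOp_pureTensor]
  exact inner_pureTensor_eq_zero_of_mem_topologicalClosure_span hf fun l =>
    he.adjoint_apply_mem_topologicalClosure_span (g l)

theorem isEigenpairSequence_xi (he : IsEigenpairSequence (S.adjoint.comp S) e lam)
    (ψ : ℕ ≃ nabla s I) (hψ : Antitone fun v => lamProd lam (ψ v : Fin d → ℕ)) :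
    IsEigenpairSequence ((symProblem s I S).adjoint.comp (symProblem s I S))
      (fun v => xi s I e (ψ v)) (fun v => lamProd lam (ψ v : Fin d → ℕ)) where
  orthonormal := (orthonormal_xi he.orthonormal).comp ψ ψ.injective
  eigen v := (adjoint_symProblem_comp_symProblem_xi (s := s) (I := I) he.eigen (ψ v) :)
  antitone := hψ
  nonneg _ := Finset.prod_nonneg fun _ _ => he.nonneg _
  exhausts _ hf := adjoint_symProblem_comp_symProblem_eq_zero he fun k hk => by
    simpa only [Equiv.apply_symm_apply] using hf (ψ.symm ⟨k, hk⟩)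

end Eigenvectors

section Ordering

open Filter Topology

variable {X α : Type*} [LinearOrder α]

theorem exists_equiv_nat_strictMono [Infinite X] {g : X → α} (hg : Function.Injective g)
    (hfin : ∀ x, {y | g y < g x}.Finite) : ∃ ψ : ℕ ≃ X, StrictMono (g ∘ ψ) := by
  let rank (x : X) : ℕ := {y | g y < g x}.ncard
  have hrank {x y : X} (hxy : g x < g y) : rank x < rank y :=
    Set.ncard_lt_ncard ⟨fun _ hz => hz.trans hxy, fun h => lt_irrefl (g x) (h hxy)⟩ (hfin y)
  have hrank_lt {x y : X} (hxy : rank x < rank y) : g x < g y := by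
    by_contra! h
    exact hxy.not_ge (h.eq_or_lt.elim (fun h => (congrArg rank (hg h)).le) fun h => (hrank h).le)
  have hinj : Function.Injective rank := fun x y hxy => hg <|
    le_antisymm (not_lt.1 fun h => (hrank h).ne' hxy) (not_lt.1 fun h => (hrank h).ne hxy)
  have : Infinite (Set.range rank) := (Set.infinite_range_of_injective hinj).to_subtype
  let o := Nat.Subtype.orderIsoOfNat (Set.range rank)
  refine ⟨o.toEquiv.trans (Equiv.ofInjective rank hinj).symm, fun v w hvw => hrank_lt ?_⟩
  have hψ (v : ℕ) : rank ((o.toEquiv.trans (Equiv.ofInjective rank hinj).symm) v) = o v :=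
    Equiv.apply_ofInjective_symm hinj (o v)
  rw [hψ, hψ]
  exact o.strictMono hvw

theorem exists_equiv_nat_antitone [Infinite X] [Countable X] {f : X → α}
    (hfin : ∀ x, {y | f x < f y}.Finite) : ∃ ψ : ℕ ≃ X, Antitone (f ∘ ψ) := by
  obtain ⟨enc, henc⟩ := exists_injective_nat X
  let g (x : X) : αᵒᵈ ×ₗ ℕ := toLex (OrderDual.toDual (f x), enc x)
  have hg : Function.Injective g := fun x y hxy => henc (Prod.ext_iff.1 (toLex.injective hxy)).2
  obtain ⟨ψ, hψ⟩ := exists_equiv_nat_strictMono hg fun x => by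
    refine ((hfin x).union ((Set.finite_Iio (enc x)).preimage henc.injOn)).subset fun y hy => ?_
    exact (Prod.Lex.toLex_lt_toLex.1 hy).imp id And.right
  exact ⟨ψ, fun v w hvw => Prod.Lex.monotone_fst _ _ (hψ.monotone hvw)⟩

variable {d : ℕ} {lam : ℕ → ℝ}

theorem lamProd_le_mul_pow (hanti : Antitone lam) (hnonneg : ∀ i, 0 ≤ lam i) {k : Fin d → ℕ}
    {m : ℕ} {l : Fin d} (hl : m ≤ k l) : lamProd lam k ≤ lam m * lam 0 ^ (d - 1) := by
  rw [lamProd, ← Finset.mul_prod_erase _ _ (Finset.mem_univ l)]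
  have hprod : ∏ i ∈ Finset.univ.erase l, lam (k i) ≤ lam 0 ^ (d - 1) := by
    refine (Finset.prod_le_prod (fun _ _ => hnonneg _) fun i _ => hanti (k i).zero_le).trans_eq ?_
    rw [Finset.prod_const, Finset.card_erase_of_mem (Finset.mem_univ l), Finset.card_univ,
      Fintype.card_fin]
  exact mul_le_mul (hanti hl) hprod (Finset.prod_nonneg fun _ _ => hnonneg _) (hnonneg m)

theorem exists_mul_pow_le_lamProd (hnonneg : ∀ i, 0 ≤ lam i) (hlim : Tendsto lam atTop (𝓝 0))
    (k : Fin d → ℕ) : ∃ m, lam m * lam 0 ^ (d - 1) ≤ lamProd lam k := by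
  have hk : 0 ≤ lamProd lam k := Finset.prod_nonneg fun l _ => hnonneg (k l)
  rcases hk.eq_or_lt with h | h
  · obtain ⟨l, -, hl⟩ := Finset.prod_eq_zero_iff.1 h.symm
    exact ⟨k l, by rw [hl, zero_mul, ← h]⟩
  · have hmul : Tendsto (fun m => lam m * lam 0 ^ (d - 1)) atTop (𝓝 0) := by
      simpa only [zero_mul] using hlim.mul_const (lam 0 ^ (d - 1))
    exact (hmul.eventually_le_const h).exists

theorem finite_setOf_lamProd_lt (hanti : Antitone lam) (hnonneg : ∀ i, 0 ≤ lam i)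
    (hlim : Tendsto lam atTop (𝓝 0)) (k : Fin d → ℕ) :
    {j : Fin d → ℕ | lamProd lam k < lamProd lam j}.Finite := by
  obtain ⟨m, hm⟩ := exists_mul_pow_le_lamProd hnonneg hlim k
  refine (Set.Finite.pi' fun _ : Fin d => Set.finite_Iio m).subset fun j hj l => ?_
  by_contra hl
  exact (hm.trans_lt hj).not_ge (lamProd_le_mul_pow hanti hnonneg (not_lt.1 hl))

theorem infinite_nabla (hd : 0 < d) (s : SymmetryType) (I : Finset (Fin d)) :
    (nabla s I).Infinite := by
  refine Set.infinite_of_injective_forall_mem (f := fun (m : ℕ) (l : Fin d) => m + (l : ℕ))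
    (fun m m' h => Nat.add_right_cancel (congrFun h ⟨0, hd⟩)) fun m => ?_
  have hmono : StrictMono fun l : Fin d => m + (l : ℕ) := fun _ _ h => Nat.add_lt_add_left h m
  cases s with
  | symmetric => exact hmono.monotone.monotoneOn _
  | antisymmetric => exact hmono.strictMonoOn _

theorem exists_equiv_nabla_antitone_lamProd (hanti : Antitone lam) (hnonneg : ∀ i, 0 ≤ lam i)
    (hlim : Tendsto lam atTop (𝓝 0)) (hd : 0 < d) (s : SymmetryType) (I : Finset (Fin d)) :
    ∃ ψ : ℕ ≃ nabla s I, Antitone fun v => lamProd lam (ψ v : Fin d → ℕ) := by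
  have : Infinite (nabla s I) := (infinite_nabla hd s I).to_subtype
  let f (k : nabla s I) : ℝ := lamProd lam (k : Fin d → ℕ)
  have hfin (k : nabla s I) : {j | f k < f j}.Finite :=
    Set.Finite.preimage (f := Subtype.val) Subtype.val_injective.injOn
      (finite_setOf_lamProd_lt hanti hnonneg hlim k.1)
  exact exists_equiv_nat_antitone hfin

end Ordering

theorem theorem1_general {H G : Type*}
    [NormedAddCommGroup H] [InnerProductSpace ℝ H] [CompleteSpace H]
    [NormedAddCommGroup G] [InnerProductSpace ℝ G] [CompleteSpace G]
    (S : H →L[ℝ] G) (e : ℕ → H) (lam : ℕ → ℝ)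
    (he : IsEigenpairSequence ((ContinuousLinearMap.adjoint S).comp S) e lam)
    (d : ℕ) (hd : 0 < d) (I : Finset (Fin d)) (s : SymmetryType) :
    (IsCompactOperator S →
      ∃ ψ : ℕ ≃ nabla s I, Antitone fun v => lamProd lam (ψ v : Fin d → ℕ)) ∧
    (∀ f : symSubspace s I H,
      (ContinuousLinearMap.adjoint (tensorOp d S)) (tensorOp d S f) =
        ((ContinuousLinearMap.adjoint (symProblem s I S) (symProblem s I S f) :
          symSubspace s I H) : HilbertTensorPower d H)) ∧
    ∀ ψ : ℕ ≃ nabla s I, (Antitone fun v => lamProd lam (ψ v : Fin d → ℕ)) →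
      IsEigenpairSequence
        ((ContinuousLinearMap.adjoint (symProblem s I S)).comp (symProblem s I S))
        (fun v => xi s I e (ψ v)) (fun v => lamProd lam (ψ v : Fin d → ℕ)) ∧
      ((Submodule.span ℝ (Set.range e)).topologicalClosure = ⊤ →
        (Submodule.span ℝ (Set.range fun v => xi s I e (ψ v))).topologicalClosure = ⊤) ∧
      ∀ n : ℕ,
        (∀ f, optAlgorithm s I S e (fun v => ψ v) n f ∈ symSubspace s I G) ∧
        optAlgorithm s I S e (fun v => ψ v) n ∈
          linAlgorithms (symSubspace s I H) (HilbertTensorPower d G) n ∧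
        worstCaseError (symProblem s I S) (optAlgorithm s I S e (fun v => ψ v) n) =
          ENNReal.ofReal √(lamProd lam (ψ n : Fin d → ℕ)) ∧
        ∀ 𝒜 : Set (symSubspace s I H → HilbertTensorPower d G),
          linAlgorithms (symSubspace s I H) (HilbertTensorPower d G) n ⊆ 𝒜 →
          𝒜 ⊆ contAlgorithms (symSubspace s I H) (HilbertTensorPower d G) n ∪
            adaptAlgorithms (symSubspace s I H) (HilbertTensorPower d G) n →
          minimalError (symProblem s I S) 𝒜 =
            ENNReal.ofReal √(lamProd lam (ψ n : Fin d → ℕ)) := by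
  refine ⟨fun hS => exists_equiv_nabla_antitone_lamProd he.antitone he.nonneg
      (he.tendsto_zero hS) hd s I,
    fun f => (coe_adjoint_symProblem_apply S f).symm, fun ψ hψ => ?_⟩
  have hxi := isEigenpairSequence_xi he ψ hψ
  refine ⟨hxi, fun htop => ?_, fun n => ⟨fun f => ?_, spectralAlgorithm_mem_linAlgorithms _ _ n,
    hxi.worstCaseError_spectralAlgorithm n, fun 𝒜 hlin h𝒜 => hxi.minimalError_eq hlin h𝒜⟩⟩
  · have hrange := ψ.surjective.range_comp fun k : nabla s I => xi s I e k
    exact hrange ▸ topologicalClosure_span_xi_eq_top htop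
  · exact Submodule.sum_mem _ fun v _ =>
      Submodule.smul_mem _ _ (tensorOp_mem_symSubspace S (Subtype.property _))

theorem theorem1 {H G : Type*}
    [NormedAddCommGroup H] [InnerProductSpace ℝ H] [CompleteSpace H]
    [TopologicalSpace.SeparableSpace H]
    [NormedAddCommGroup G] [InnerProductSpace ℝ G] [CompleteSpace G]
    (S : H →L[ℝ] G) (hS : IsCompactOperator S)
    (e : ℕ → H) (lam : ℕ → ℝ)
    (he : IsEigenpairSequence ((ContinuousLinearMap.adjoint S).comp S) e lam)
    (d : ℕ) (hd : 1 < d) (I : Finset (Fin d)) (hI : I.Nonempty) (s : SymmetryType) :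
    (∃ ψ : ℕ ≃ nabla s I, Antitone fun v => lamProd lam (ψ v : Fin d → ℕ)) ∧
    (∀ f : symSubspace s I H,
      (ContinuousLinearMap.adjoint (tensorOp d S)) (tensorOp d S f) =
        ((ContinuousLinearMap.adjoint (symProblem s I S) (symProblem s I S f) :
          symSubspace s I H) : HilbertTensorPower d H)) ∧
    ∀ ψ : ℕ ≃ nabla s I, (Antitone fun v => lamProd lam (ψ v : Fin d → ℕ)) →
      IsEigenpairSequence
        ((ContinuousLinearMap.adjoint (symProblem s I S)).comp (symProblem s I S))
        (fun v => xi s I e (ψ v)) (fun v => lamProd lam (ψ v : Fin d → ℕ)) ∧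
      ((Submodule.span ℝ (Set.range e)).topologicalClosure = ⊤ →
        (Submodule.span ℝ (Set.range fun v => xi s I e (ψ v))).topologicalClosure = ⊤) ∧
      ∀ n : ℕ,
        (∀ f, optAlgorithm s I S e (fun v => ψ v) n f ∈ symSubspace s I G) ∧
        optAlgorithm s I S e (fun v => ψ v) n ∈
          linAlgorithms (symSubspace s I H) (HilbertTensorPower d G) n ∧
        worstCaseError (symProblem s I S) (optAlgorithm s I S e (fun v => ψ v) n) =
          ENNReal.ofReal √(lamProd lam (ψ n : Fin d → ℕ)) ∧
        ∀ 𝒜 : Set (symSubspace s I H → HilbertTensorPower d G),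
          linAlgorithms (symSubspace s I H) (HilbertTensorPower d G) n ⊆ 𝒜 →
          𝒜 ⊆ contAlgorithms (symSubspace s I H) (HilbertTensorPower d G) n ∪
            adaptAlgorithms (symSubspace s I H) (HilbertTensorPower d G) n →
          minimalError (symProblem s I S) 𝒜 =
            ENNReal.ofReal √(lamProd lam (ψ n : Fin d → ℕ)) := by
  obtain ⟨hexists, hrest⟩ := theorem1_general S e lam he d (zero_lt_one.trans hd) I s
  exact ⟨hexists hS, hrest⟩
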